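/- Composition is written in diagrammatic order: $RS$ or $R\cdot S$ means first $R$, then $S$. Coherence isomorphisms of monoidal categories are suppressed. **Bicategories of relations.** A *bicategory of relations* is a locally posetal 2-category $\mathcal B$ (every hom-set is partially ordered, the order relation being the 2-morphisms, and composition is monotone) which is also a symmetric monoidal category $(\mathcal B,\otimes,I)$, with $\otimes$ monotone on morphisms, with diagonals, i.e. every object $X$ carries a cocommutative comonoid $\Delta_X\colon X\to X\otimes X$, $\lozenge_X\colon X\to I$, these being compatible with $\otimes$ and $I$ in the usual way, such that * every $R\colon X\to Y$ is a lax comonoid homomorphism: $R\,\Delta_Y\le\Delta_X(R\otimes R)$ and $R\,\lozenge_Y\le\lozenge_X$; * $\Delta_X$ and $\lozenge_X$ have right adjoints $\nabla_X$ and $\square_X$ (where $g$ is right adjoint to $f\colon X\to Y$ if $1_X\le fg$ and $gf\le 1_Y$); * the Frobenius equations hold: $(1\otimes\Delta_X)(\nabla_X\otimes1)=\nabla_X\Delta_X=(\Delta_X\otimes1)(1\otimes\nabla_X)$. A *map* is a morphism that has a right adjoint. $\mathbf{BiRel}$ is the category of small bicategories of relations and structure-preserving functors, i.e. (strong) symmetric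 monoidal functors that preserve 2-morphisms and diagonals. **Regular logic with product types.** A *signature* consists of a set of basic types, generating the types $A,B::=C\mid A\times B\mid 1$ ($C$ basic), a set of function symbols $f\colon A\to B$ and a set of relation symbols $R:(A,B)$, where $A,B$ are types. Terms in context $\Gamma\mid t:A$ are generated by the variables of $\Gamma$, $f(t)$, $\langle t,s\rangle$, $\pi_1(t)$, $\pi_2(t)$ and $*:1$. Formulas in context $\Gamma\mid\varphi$ are generated by $R(t,s)$, $t=s$, $\top$, $\varphi\wedge\psi$ and $\exists x:A.\varphi$. A *theory* $\mathbb T$ is a set of sequents $\Gamma\mid\varphi\vdash\psi$, its axioms; its theorems are the sequents that are deducible from the axioms by the following rules (where $\vdash\psi$ abbreviates $\top\vdash\psi$): $\varphi\vdash\varphi$; cut; simultaneous substitution of terms for variables; $\vdash x=x$, $(\vec x=\vec y)\wedge\varphi\vdash\varphi[\vec y/\vec x]$, $\vec x=\vec y\vdash t=t[\vec y/\vec x]$; $\vdash\pi_1\langle t,s\rangle=t$, $\vdash\pi_2\langle t,s\rangle=s$, $\vdash\langle\pi_1t,\pi_2t\rangle=t$; $\vdash t=*$ for $t:1$; $\varphi\vdash\top$;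 $\varphi\wedge\psi\vdash\varphi$, $\varphi\wedge\psi\vdash\psi$, and from $\varphi\vdash\psi$ and $\varphi\vdash\chi$ infer $\varphi\vdash\psi\wedge\chi$; $\Gamma,x:A\mid\varphi\vdash\psi$ if and only if $\Gamma\mid\exists x:A.\varphi\vdash\psi$, for $x$ not in $\Gamma$ (two rules); $\varphi\wedge\exists x:A.\psi\vdash\exists x:A.(\varphi\wedge\psi)$, for $x$ not in $\Gamma$. **Classifying category.** $\mathrm{Cl}(\mathbb T)$ is the bicategory of relations whose objects are the types, whose morphisms $A\to B$ are the classes $[x:A,y:B\mid\varphi]$ of formulas up to renaming of variables and provable equivalence under $\mathbb T$, ordered by $[\varphi]\le[\psi]$ if $x:A,y:B\mid\varphi\vdash\psi$ is a theorem of $\mathbb T$, with $$[x:A,y:B\mid\varphi]\cdot[y:B,z:C\mid\psi]=[x:A,z:C\mid\exists y:B.(\varphi\wedge\psi)],\qquad 1_A=[x:A,x':A\mid x=x'],$$ $A\otimes B=A\times B$, $I=1$, $$[x_1:A_1,y_1:B_1\mid\varphi]\otimes[x_2:A_2,y_2:B_2\mid\psi]=[x:A_1\times A_2,\,y:B_1\times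 B_2\mid\varphi[\pi_1x/x_1,\pi_1y/y_1]\wedge\psi[\pi_2x/x_2,\pi_2y/y_2]],$$ braidings $[x:A\times B,\,y:B\times A\mid\pi_1x=\pi_2y\wedge\pi_2x=\pi_1y]$, the associators and unitors being the graphs of the evident terms, and $\Delta_A=[x:A,y:A\times A\mid\langle x,x\rangle=y]$, $\lozenge_A=[x:A,y:1\mid\top]$. **Interpretations.** Given, in a bicategory of relations $\mathcal B$, an object $[\![C]\!]$ for each basic type $C$, put $[\![A\times B]\!]=[\![A]\!]\otimes[\![B]\!]$, $[\![1]\!]=I$, and let $[\![\Gamma]\!]$ be the tensor product of the interpretations of the types in $\Gamma$. Given moreover a map $[\![f]\!]\colon[\![A]\!]\to[\![B]\!]$ for each $f\colon A\to B$ and a morphism $[\![R]\!]\colon[\![A]\!]\to[\![B]\!]$ for each $R:(A,B)$, a term $\Gamma\mid t:A$ is interpreted as a morphism $[\![\Gamma]\!]\to[\![A]\!]$ and a formula $\Gamma\mid\varphi$ as a morphism $[\![\Gamma]\!]\to I$: a variable deletes all the other variables; $[\![f(t)]\!]=[\![t]\!][\![f]\!]$; $[\![\langle t,s\rangle]\!]=\Delta([\![t]\!]\otimes[\![s]\!])$;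 $[\![\pi_1t]\!]=[\![t]\!](1\otimes\lozenge)$, $[\![\pi_2t]\!]=[\![t]\!](\lozenge\otimes1)$; $[\![*]\!]=\lozenge$; $[\![R(t,s)]\!]=\Delta([\![t]\!][\![R]\!]\otimes[\![s]\!])\nabla\lozenge$; $[\![t=s]\!]=\Delta([\![t]\!]\otimes[\![s]\!])\nabla\lozenge$; $[\![\top]\!]=\lozenge$; $[\![\varphi\wedge\psi]\!]=\Delta([\![\varphi]\!]\otimes[\![\psi]\!])\nabla_I$; and, for a formula $\varphi$ in context $\Gamma,x:A$, $[\![\Gamma\mid\exists x:A.\varphi]\!]=\widehat{[\![\varphi]\!]}\,\lozenge_{[\![A]\!]}$, where $\widehat{[\![\varphi]\!]}=(1_{[\![\Gamma]\!]}\otimes\square\Delta)([\![\varphi]\!]\otimes 1_{[\![A]\!]})\colon[\![\Gamma]\!]\to[\![A]\!]$ is obtained by moving the variable $x$ to the codomain. **Internal language.** For a small bicategory of relations $\mathcal B$, the theory $\mathrm{Lang}(\mathcal B)$ has a basic type for every object of $\mathcal B$, a function symbol $f\colon A\to B$ for every pair of types $(A,B)$ and every map $f\colon[\![A]\!]\to[\![B]\!]$,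 and a relation symbol $R:(A,B)$ for every pair of types $(A,B)$ and every morphism $R\colon[\![A]\!]\to[\![B]\!]$; a sequent $\Gamma\mid\varphi\vdash\psi$ is an axiom if and only if $[\![\Gamma\mid\varphi]\!]\le[\![\Gamma\mid\psi]\!]$ in $\mathcal B$, where $[\![\cdot]\!]$ is the obvious interpretation. **Theorem.** For every small bicategory of relations $\mathcal B$ there is an equivalence $$\mathrm{Cl}(\mathrm{Lang}(\mathcal B))\simeq\mathcal B\qquad\text{in }\mathbf{BiRel},$$ that is, an equivalence of categories given by structure-preserving functors in both directions, whose unit and counit are monoidal natural isomorphisms. -/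

import Mathlib

open CategoryTheory MonoidalCategory

universe u v u₁ v₁ u₂ v₂

section

open ComonObj

/-- A bicategory of relations: a locally posetal 2-category which is a symmetric monoidal category
with diagonals (`CopyDiscardCategory`), such that every morphism is a lax comonoid homomorphism,
the diagonals have right adjoints, and the Frobenius equations hold. Composition is written in
diagrammatic order. A right adjoint in a locally posetal 2-category is unique if it exists, so that
`merge` and `create` are determined by the rest of the structure. -/
class BicategoryOfRelations (C : Type u) [Category.{v} C] [MonoidalCategory.{v} C]
    extends CopyDiscardCategory C where
  /-- The 2-morphisms. -/
  [homOrder : ∀ X Y : C, PartialOrder (X ⟶ Y)]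
  /-- Horizontal composition of 2-morphisms. -/
  comp_mono {X Y Z : C} {R R' : X ⟶ Y} {S S' : Y ⟶ Z} :
    R ≤ R' → S ≤ S' → R ≫ S ≤ R' ≫ S'
  /-- The monoidal product acts on 2-morphisms. -/
  tensor_mono {X Y Z W : C} {R R' : X ⟶ Y} {S S' : Z ⟶ W} :
    R ≤ R' → S ≤ S' → R ⊗ₘ S ≤ R' ⊗ₘ S'
  lax_copy {X Y : C} (R : X ⟶ Y) : R ≫ Δ[Y] ≤ Δ[X] ≫ (R ⊗ₘ R)
  lax_discard {X Y : C} (R : X ⟶ Y) : R ≫ ε[Y] ≤ ε[X]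
  /-- The right adjoint of the duplication morphism. -/
  merge (X : C) : X ⊗ X ⟶ X
  /-- The right adjoint of the deletion morphism. -/
  create (X : C) : 𝟙_ C ⟶ X
  copy_adj_unit (X : C) : 𝟙 X ≤ Δ[X] ≫ merge X
  copy_adj_counit (X : C) : merge X ≫ Δ[X] ≤ 𝟙 (X ⊗ X)
  discard_adj_unit (X : C) : 𝟙 X ≤ ε[X] ≫ create X
  discard_adj_counit (X : C) : create X ≫ ε[X] ≤ 𝟙 (𝟙_ C)
  frobenius_left (X : C) : X ◁ Δ[X] ≫ (α_ X X X).inv ≫ merge X ▷ X = merge X ≫ Δ[X]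
  frobenius_right (X : C) : Δ[X] ▷ X ≫ (α_ X X X).hom ≫ X ◁ merge X = merge X ≫ Δ[X]

attribute [reducible, instance] BicategoryOfRelations.homOrder

namespace BicategoryOfRelations

section

variable {C : Type u} [Category.{v} C] [MonoidalCategory.{v} C] [BicategoryOfRelations C]

/-- A morphism is a map if it has a right adjoint. -/
def IsMap {X Y : C} (f : X ⟶ Y) : Prop :=
  ∃ g : Y ⟶ X, 𝟙 X ≤ f ≫ g ∧ g ≫ f ≤ 𝟙 Y

/-- The counit `X ⊗ X ⟶ I` of the self-dual compact closed structure. -/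
def cap (X : C) : X ⊗ X ⟶ 𝟙_ C := merge X ≫ ε[X]

/-- The unit `I ⟶ X ⊗ X` of the self-dual compact closed structure. -/
def cup (X : C) : 𝟙_ C ⟶ X ⊗ X := create X ≫ Δ[X]

/-- Bending the last input wire to an output wire. -/
def bend {X Y : C} (R : X ⊗ Y ⟶ 𝟙_ C) : X ⟶ Y :=
  (ρ_ X).inv ≫ X ◁ cup Y ≫ (α_ X Y Y).inv ≫ R ▷ Y ≫ (λ_ Y).hom

end

section

variable (C : Type u₁) [Category.{v₁} C] [MonoidalCategory.{v₁} C] [BicategoryOfRelations C]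
  (D : Type u₂) [Category.{v₂} D] [MonoidalCategory.{v₂} D] [BicategoryOfRelations D]

/-- The (strong) symmetric monoidal functor `F` is a structure-preserving functor of bicategories of
relations: it preserves 2-morphisms and diagonals, up to the coherence isomorphisms of `F`. Then it
also preserves the right adjoints of the diagonals. -/
structure PreservesStructure {C : Type u₁} [Category.{v₁} C] [MonoidalCategory.{v₁} C]
    [BicategoryOfRelations C] {D : Type u₂} [Category.{v₂} D] [MonoidalCategory.{v₂} D]
    [BicategoryOfRelations D] (F : C ⥤ D) [F.Braided] : Prop where
  map_mono {X Y : C} {R S : X ⟶ Y} : R ≤ S → F.map R ≤ F.map S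
  map_copy (X : C) : F.map Δ[X] = Δ[F.obj X] ≫ Functor.LaxMonoidal.μ F X X
  map_discard (X : C) : F.map ε[X] = ε[F.obj X] ≫ Functor.LaxMonoidal.ε F

/-- An equivalence of bicategories of relations: an equivalence of categories whose functors both
preserve the structure and whose unit and counit are monoidal natural isomorphisms. -/
structure StructuredEquivalence where
  toEquivalence : C ≌ D
  [functorBraided : toEquivalence.functor.Braided]
  [inverseBraided : toEquivalence.inverse.Braided]
  isMonoidal : toEquivalence.IsMonoidal
  functor_preserves : PreservesStructure toEquivalence.functor
  inverse_preserves : PreservesStructure toEquivalence.inverse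

end

end BicategoryOfRelations

end

namespace RegularLogic

/-- The types generated by a set of basic types: product types and the singleton type. -/
inductive Ty (C : Type u) : Type u
  | basic (c : C) : Ty C
  | prod (A B : Ty C) : Ty C
  | unit : Ty C

/-- A signature of regular logic with product types. -/
structure Signature : Type (max (u + 1) (v + 1)) where
  BasicType : Type u
  /-- The function symbols `f : A → B`. -/
  Fun : Ty BasicType → Ty BasicType → Type v
  /-- The relation symbols `R : (A, B)`. -/
  Rel : Ty BasicType → Ty BasicType → Type v

/-- The types (basic or compound) over a signature. -/
abbrev Signature.Typ (S : Signature.{u, v}) : Type u := Ty S.BasicType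

/-- Contexts up to renaming of variables. The head of the list is the type of the last variable,
so `A :: Γ` is the context `Γ, x : A` and `[B, A]` is the context `x : A, y : B`. -/
abbrev Ctx (S : Signature.{u, v}) : Type u := List S.Typ

/-- `Var Γ A` is the set of variables of type `A` in the context `Γ` (de Bruijn indices). -/
inductive Var {C : Type u} : List (Ty C) → Ty C → Type u
  | zero {Γ : List (Ty C)} {A : Ty C} : Var (A :: Γ) A
  | succ {Γ : List (Ty C)} {A B : Ty C} (x : Var Γ A) : Var (B :: Γ) A

/-- Terms in context `Γ | t : A`. -/
inductive Term (S : Signature.{u, v}) (Γ : Ctx S) : S.Typ → Type (max u v)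
  | var {A : S.Typ} (x : Var Γ A) : Term S Γ A
  | app {A B : S.Typ} (f : S.Fun A B) (t : Term S Γ A) : Term S Γ B
  | pair {A B : S.Typ} (t : Term S Γ A) (s : Term S Γ B) : Term S Γ (.prod A B)
  | fst {A B : S.Typ} (t : Term S Γ (.prod A B)) : Term S Γ A
  | snd {A B : S.Typ} (t : Term S Γ (.prod A B)) : Term S Γ B
  | star : Term S Γ .unit

/-- Formulas in context `Γ | φ`, up to renaming of variables. -/
inductive Formula (S : Signature.{u, v}) : Ctx S → Type (max u v)
  | rel {Γ : Ctx S} {A B : S.Typ} (R : S.Rel A B) (t : Term S Γ A) (s : Term S Γ B) : Formula S Γ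
  | eq {Γ : Ctx S} {A : S.Typ} (t s : Term S Γ A) : Formula S Γ
  | top {Γ : Ctx S} : Formula S Γ
  | and {Γ : Ctx S} (φ ψ : Formula S Γ) : Formula S Γ
  | ex {Γ : Ctx S} {A : S.Typ} (φ : Formula S (A :: Γ)) : Formula S Γ

/-- Tuples of terms: for each variable of `Δ`, a term of the same type in context `Γ`. -/
def Subst (S : Signature.{u, v}) (Γ Δ : Ctx S) : Type (max u v) :=
  ∀ A : S.Typ, Var Δ A → Term S Γ A

variable {S : Signature.{u, v}}

/-- Simultaneous substitution in a term. -/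
def Term.subst {Γ Δ : Ctx S} (σ : Subst S Γ Δ) : {A : S.Typ} → Term S Δ A → Term S Γ A
  | _, .var x => σ _ x
  | _, .app f t => .app f (t.subst σ)
  | _, .pair t s => .pair (t.subst σ) (s.subst σ)
  | _, .fst t => .fst (t.subst σ)
  | _, .snd t => .snd (t.subst σ)
  | _, .star => .star

namespace Subst

/-- The identity substitution. -/
def id (Γ : Ctx S) : Subst S Γ Γ := fun _ x => .var x

/-- The projection from the context `Γ, x : A` to the context `Γ`. -/
def wk (Γ : Ctx S) (A : S.Typ) : Subst S (A :: Γ) Γ := fun _ x => .var x.succ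

/-- The empty tuple of terms. -/
def nil (Γ : Ctx S) : Subst S Γ [] := fun _ x => nomatch x

/-- Extension of a tuple of terms by a further term. -/
def cons {Γ Δ : Ctx S} {A : S.Typ} (σ : Subst S Γ Δ) (t : Term S Γ A) : Subst S Γ (A :: Δ)
  | _, .zero => t
  | _, .succ x => σ _ x

/-- `(σ.comp τ)` is the substitution `σ` followed by the substitution `τ`. -/
def comp {Γ Δ Θ : Ctx S} (σ : Subst S Δ Θ) (τ : Subst S Γ Δ) : Subst S Γ Θ :=
  fun _ x => (σ _ x).subst τ

/-- The extension of a substitution to a further variable, which is left fixed. -/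
def lift {Γ Δ : Ctx S} (σ : Subst S Γ Δ) (A : S.Typ) : Subst S (A :: Γ) (A :: Δ) :=
  (σ.comp (wk Γ A)).cons (.var .zero)

/-- The pair of terms `s : A`, `t : B`, as a substitution for the variables of `x : A, y : B`. -/
def two {Γ : Ctx S} {A B : S.Typ} (s : Term S Γ A) (t : Term S Γ B) : Subst S Γ [B, A] :=
  ((nil Γ).cons s).cons t

end Subst

/-- Simultaneous (capture-avoiding) substitution in a formula. -/
def Formula.subst : {Γ Δ : Ctx S} → Subst S Γ Δ → Formula S Δ → Formula S Γ
  | _, _, σ, .rel R t s => .rel R (t.subst σ) (s.subst σ)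
  | _, _, σ, .eq t s => .eq (t.subst σ) (s.subst σ)
  | _, _, _, .top => .top
  | _, _, σ, .and φ ψ => .and (φ.subst σ) (ψ.subst σ)
  | _, _, σ, .ex (A := A) φ => .ex (φ.subst (σ.lift A))

/-- Weakening of a term. -/
def Term.wk {Γ : Ctx S} {A : S.Typ} (B : S.Typ) (t : Term S Γ A) : Term S (B :: Γ) A :=
  t.subst (Subst.wk Γ B)

/-- Weakening of a formula. -/
def Formula.wk {Γ : Ctx S} (B : S.Typ) (φ : Formula S Γ) : Formula S (B :: Γ) :=
  φ.subst (Subst.wk Γ B)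

/-- The term `r[t/x]`, for a term `r` in context `Γ, x : A`. -/
def Term.inst {Γ : Ctx S} {A B : S.Typ} (r : Term S (A :: Γ) B) (t : Term S Γ A) : Term S Γ B :=
  r.subst ((Subst.id Γ).cons t)

/-- The formula `φ[t/x]`, for a formula `φ` in context `Γ, x : A`. -/
def Formula.inst {Γ : Ctx S} {A : S.Typ} (φ : Formula S (A :: Γ)) (t : Term S Γ A) : Formula S Γ :=
  φ.subst ((Subst.id Γ).cons t)

/-- The formula `φ(s, t)`, for a formula `φ` in context `x : A, y : B`. -/
def Formula.at {Γ : Ctx S} {A B : S.Typ} (φ : Formula S [B, A]) (s : Term S Γ A)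
    (t : Term S Γ B) : Formula S Γ :=
  φ.subst (Subst.two s t)

/-- The term `t(s)`, for a term `t` in context `x : A`. -/
def Term.ap {Γ : Ctx S} {A B : S.Typ} (t : Term S [A] B) (s : Term S Γ A) : Term S Γ B :=
  t.subst ((Subst.nil Γ).cons s)

variable (S) in
/-- A theory: a set of sequents `Γ | φ ⊢ ψ` over the signature, the axioms of the theory. -/
structure Theory where
  Axiom : ∀ Γ : Ctx S, Formula S Γ → Formula S Γ → Prop

/-- The theorems `Γ | φ ⊢ ψ` of a theory: the sequents that are deducible from its axioms by the
inference rules of regular logic with product types. -/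
inductive Theory.Entails (T : Theory S) : ∀ {Γ : Ctx S}, Formula S Γ → Formula S Γ → Prop
  | ax {Γ : Ctx S} {φ ψ : Formula S Γ} : T.Axiom Γ φ ψ → T.Entails φ ψ
  | identity {Γ : Ctx S} (φ : Formula S Γ) : T.Entails φ φ
  | cut {Γ : Ctx S} {φ χ ψ : Formula S Γ} : T.Entails φ χ → T.Entails χ ψ → T.Entails φ ψ
  | substitution {Γ Δ : Ctx S} {φ ψ : Formula S Δ} (σ : Subst S Γ Δ) :
      T.Entails φ ψ → T.Entails (φ.subst σ) (ψ.subst σ)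
  | eq_refl {Γ : Ctx S} {A : S.Typ} (t : Term S Γ A) : T.Entails .top (.eq t t)
  | eq_formula {Γ : Ctx S} {A : S.Typ} (φ : Formula S (A :: Γ)) (t s : Term S Γ A) :
      T.Entails (.and (.eq t s) (φ.inst t)) (φ.inst s)
  | eq_term {Γ : Ctx S} {A B : S.Typ} (r : Term S (A :: Γ) B) (t s : Term S Γ A) :
      T.Entails (.eq t s) (.eq (r.inst t) (r.inst s))
  | proj_fst {Γ : Ctx S} {A B : S.Typ} (t : Term S Γ A) (s : Term S Γ B) :
      T.Entails .top (.eq (.fst (.pair t s)) t)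
  | proj_snd {Γ : Ctx S} {A B : S.Typ} (t : Term S Γ A) (s : Term S Γ B) :
      T.Entails .top (.eq (.snd (.pair t s)) s)
  | pair_eta {Γ : Ctx S} {A B : S.Typ} (t : Term S Γ (.prod A B)) :
      T.Entails .top (.eq (.pair (.fst t) (.snd t)) t)
  | singleton {Γ : Ctx S} (t : Term S Γ .unit) : T.Entails .top (.eq t .star)
  | truth {Γ : Ctx S} (φ : Formula S Γ) : T.Entails φ .top
  | and_intro {Γ : Ctx S} {φ ψ χ : Formula S Γ} :
      T.Entails φ ψ → T.Entails φ χ → T.Entails φ (.and ψ χ)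
  | and_left {Γ : Ctx S} (φ ψ : Formula S Γ) : T.Entails (.and φ ψ) φ
  | and_right {Γ : Ctx S} (φ ψ : Formula S Γ) : T.Entails (.and φ ψ) ψ
  | ex_down {Γ : Ctx S} {A : S.Typ} {φ : Formula S (A :: Γ)} {ψ : Formula S Γ} :
      T.Entails φ (ψ.wk A) → T.Entails (.ex φ) ψ
  | ex_up {Γ : Ctx S} {A : S.Typ} {φ : Formula S (A :: Γ)} {ψ : Formula S Γ} :
      T.Entails (.ex φ) ψ → T.Entails φ (ψ.wk A)
  | frobenius {Γ : Ctx S} {A : S.Typ} (φ : Formula S Γ) (ψ : Formula S (A :: Γ)) :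
      T.Entails (.and φ (.ex ψ)) (.ex (.and (φ.wk A) ψ))

/-! ### Substitution lemmas -/

@[simp] theorem Subst.cons_zero {Γ Δ : Ctx S} {A : S.Typ} (σ : Subst S Γ Δ) (t : Term S Γ A) :
    σ.cons t A .zero = t := rfl

@[simp] theorem Subst.cons_succ {Γ Δ : Ctx S} {A B : S.Typ} (σ : Subst S Γ Δ) (t : Term S Γ A)
    (x : Var Δ B) : σ.cons t B x.succ = σ B x := rfl

@[simp] theorem Subst.wk_apply {Γ : Ctx S} {A B : S.Typ} (x : Var Γ B) :
    Subst.wk Γ A B x = .var x.succ := rfl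

@[simp] theorem Subst.id_apply {Γ : Ctx S} {B : S.Typ} (x : Var Γ B) :
    Subst.id Γ B x = .var x := rfl

theorem Term.subst_subst {Γ Δ Θ : Ctx S} (σ : Subst S Δ Θ) (τ : Subst S Γ Δ) {A : S.Typ}
    (t : Term S Θ A) : (t.subst σ).subst τ = t.subst (σ.comp τ) := by
  induction t <;> simp_all [Term.subst, Subst.comp]

@[simp] theorem Term.subst_id {Γ : Ctx S} {A : S.Typ} (t : Term S Γ A) :
    t.subst (Subst.id Γ) = t := by
  induction t <;> simp_all [Term.subst]

theorem Subst.comp_assoc {Γ Δ Θ Ξ : Ctx S} (σ : Subst S Θ Ξ) (τ : Subst S Δ Θ) (ρ : Subst S Γ Δ) :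
    (σ.comp τ).comp ρ = σ.comp (τ.comp ρ) := by
  funext A x
  exact Term.subst_subst τ ρ (σ A x)

@[simp] theorem Subst.comp_id {Γ Δ : Ctx S} (σ : Subst S Γ Δ) : σ.comp (Subst.id Γ) = σ := by
  funext A x
  simp [Subst.comp]

@[simp] theorem Subst.id_comp {Γ Δ : Ctx S} (σ : Subst S Γ Δ) : (Subst.id Δ).comp σ = σ := rfl

@[simp] theorem Subst.wk_comp_cons {Γ Δ : Ctx S} {A : S.Typ} (σ : Subst S Γ Δ) (t : Term S Γ A) :
    (Subst.wk Δ A).comp (σ.cons t) = σ := rfl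

@[simp] theorem Subst.cons_comp {Γ Δ Θ : Ctx S} {A : S.Typ} (σ : Subst S Δ Θ) (t : Term S Δ A)
    (τ : Subst S Γ Δ) : (σ.cons t).comp τ = (σ.comp τ).cons (t.subst τ) := by
  funext B x
  cases x <;> rfl

theorem Subst.eq_nil {Γ : Ctx S} (σ : Subst S Γ []) : σ = Subst.nil Γ := by
  funext B x
  cases x

theorem Subst.lift_comp_lift {Γ Δ Θ : Ctx S} (σ : Subst S Δ Θ) (τ : Subst S Γ Δ) (A : S.Typ) :
    (σ.lift A).comp (τ.lift A) = (σ.comp τ).lift A := by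
  simp only [Subst.lift, Subst.cons_comp, Subst.comp_assoc, Subst.wk_comp_cons]
  rfl

@[simp] theorem Subst.lift_id (Γ : Ctx S) (A : S.Typ) :
    (Subst.id Γ).lift A = Subst.id (A :: Γ) := by
  funext B x
  cases x <;> rfl

theorem Formula.subst_subst {Γ Δ Θ : Ctx S} (σ : Subst S Δ Θ) (τ : Subst S Γ Δ)
    (φ : Formula S Θ) : (φ.subst σ).subst τ = φ.subst (σ.comp τ) := by
  induction φ generalizing Γ Δ <;>
    simp_all [Formula.subst, Term.subst_subst, Subst.lift_comp_lift]

@[simp] theorem Formula.subst_id {Γ : Ctx S} (φ : Formula S Γ) : φ.subst (Subst.id Γ) = φ := by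
  induction φ <;> simp_all [Formula.subst]

@[simp] theorem Subst.two_comp {Γ Δ : Ctx S} {A B : S.Typ} (s : Term S Δ A) (t : Term S Δ B)
    (σ : Subst S Γ Δ) : (Subst.two s t).comp σ = Subst.two (s.subst σ) (t.subst σ) := by
  simp only [Subst.two, Subst.cons_comp]
  rw [Subst.eq_nil ((Subst.nil Δ).comp σ)]

theorem Subst.two_eta {Γ : Ctx S} {A B : S.Typ} (σ : Subst S Γ [B, A]) :
    σ = Subst.two (σ A (.succ .zero)) (σ B .zero) := by
  funext C x
  rcases x with _ | x
  · rfl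
  · rcases x with _ | x
    · rfl
    · cases x

@[simp] theorem Formula.at_subst {Γ Δ : Ctx S} {A B : S.Typ} (φ : Formula S [B, A])
    (s : Term S Δ A) (t : Term S Δ B) (σ : Subst S Γ Δ) :
    (φ.at s t).subst σ = φ.at (s.subst σ) (t.subst σ) := by
  simp [Formula.at, Formula.subst_subst]

@[simp] theorem Formula.at_at {Γ : Ctx S} {A B A' B' : S.Typ} (φ : Formula S [B, A])
    (s : Term S [B', A'] A) (t : Term S [B', A'] B) (s' : Term S Γ A') (t' : Term S Γ B') :
    (φ.at s t).at s' t' = φ.at (s.subst (Subst.two s' t')) (t.subst (Subst.two s' t')) :=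
  Formula.at_subst ..

theorem Formula.at_vars {A B : S.Typ} (φ : Formula S [B, A]) :
    φ.at (.var (.succ .zero)) (.var .zero) = φ := by
  have h := Subst.two_eta (Subst.id (S := S) [B, A])
  simp only [Subst.id_apply] at h
  rw [Formula.at, ← h, Formula.subst_id]

@[simp] theorem Subst.two_zero {Γ : Ctx S} {A B : S.Typ} (s : Term S Γ A) (t : Term S Γ B) :
    Subst.two s t B .zero = t := rfl

@[simp] theorem Subst.two_one {Γ : Ctx S} {A B : S.Typ} (s : Term S Γ A) (t : Term S Γ B) :
    Subst.two s t A (.succ .zero) = s := rfl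

@[simp] theorem Term.var_subst {Γ Δ : Ctx S} {A : S.Typ} (σ : Subst S Γ Δ) (x : Var Δ A) :
    (Term.var x).subst σ = σ A x := rfl

@[simp] theorem Formula.at_wk {Γ : Ctx S} {A B D : S.Typ} (φ : Formula S [B, A])
    (s : Term S Γ A) (t : Term S Γ B) : (φ.at s t).wk D = φ.at (s.wk D) (t.wk D) :=
  Formula.at_subst ..

@[simp] theorem Formula.wk_inst {Γ : Ctx S} {A : S.Typ} (φ : Formula S Γ) (t : Term S Γ A) :
    (φ.wk A).inst t = φ := by
  simp [Formula.wk, Formula.inst, Formula.subst_subst]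

@[simp] theorem Term.wk_inst {Γ : Ctx S} {A B : S.Typ} (s : Term S Γ B) (t : Term S Γ A) :
    (s.wk A).inst t = s := by
  simp [Term.wk, Term.inst, Term.subst_subst]

@[simp] theorem Term.wk_subst_cons {Γ : Ctx S} {A B : S.Typ} (s : Term S Γ B) (t : Term S Γ A) :
    (s.wk A).subst ((Subst.id Γ).cons t) = s :=
  Term.wk_inst s t

/-! ### Derived rules -/

namespace Theory.Entails

variable {T : Theory S} {Γ : Ctx S}

theorem left {θ φ ψ : Formula S Γ} (h : T.Entails θ (.and φ ψ)) : T.Entails θ φ :=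
  h.cut (and_left φ ψ)

theorem right {θ φ ψ : Formula S Γ} (h : T.Entails θ (.and φ ψ)) : T.Entails θ ψ :=
  h.cut (and_right φ ψ)

theorem of_top {θ φ : Formula S Γ} (h : T.Entails .top φ) : T.Entails θ φ :=
  (truth θ).cut h

theorem assume {θ ψ : Formula S Γ} (h : ∀ θ' : Formula S Γ, T.Entails θ' θ → T.Entails θ' ψ) :
    T.Entails θ ψ :=
  h θ (identity θ)

theorem wk {A : S.Typ} {φ ψ : Formula S Γ} (h : T.Entails φ ψ) :
    T.Entails (φ.wk A) (ψ.wk A) :=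
  h.substitution _

theorem ex_intro {A : S.Typ} {θ : Formula S Γ} {φ : Formula S (A :: Γ)} (t : Term S Γ A)
    (h : T.Entails θ (φ.inst t)) : T.Entails θ (.ex φ) := by
  refine h.cut ?_
  have := (ex_up (identity (T := T) (.ex φ))).substitution ((Subst.id Γ).cons t)
  rwa [← Formula.inst, ← Formula.inst, Formula.wk_inst] at this

theorem ex_elim {A : S.Typ} {θ χ : Formula S Γ} {φ : Formula S (A :: Γ)}
    (h : T.Entails θ (.ex φ)) (h' : T.Entails (.and (θ.wk A) φ) (χ.wk A)) : T.Entails θ χ :=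
  (((identity θ).and_intro h).cut (frobenius θ φ)).cut (ex_down h')

theorem subst_eq {A : S.Typ} {θ : Formula S Γ} (φ : Formula S (A :: Γ)) {t s : Term S Γ A}
    (h : T.Entails θ (.eq t s)) (h' : T.Entails θ (φ.inst t)) : T.Entails θ (φ.inst s) :=
  (h.and_intro h').cut (eq_formula φ t s)

theorem refl' {A : S.Typ} {θ : Formula S Γ} (t : Term S Γ A) : T.Entails θ (.eq t t) :=
  of_top (eq_refl t)

theorem symm' {A : S.Typ} {θ : Formula S Γ} {t s : Term S Γ A} (h : T.Entails θ (.eq t s)) :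
    T.Entails θ (.eq s t) := by
  have := subst_eq (.eq (.var .zero) (t.wk A)) h
  change T.Entails θ (.eq t ((t.wk A).inst t)) → T.Entails θ (.eq s ((t.wk A).inst s)) at this
  rw [Term.wk_inst, Term.wk_inst] at this
  exact this (refl' t)

theorem trans' {A : S.Typ} {θ : Formula S Γ} {t s r : Term S Γ A} (h : T.Entails θ (.eq t s))
    (h' : T.Entails θ (.eq s r)) : T.Entails θ (.eq t r) := by
  have := subst_eq (.eq (t.wk A) (.var .zero)) h'
  change T.Entails θ (.eq ((t.wk A).inst s) s) → T.Entails θ (.eq ((t.wk A).inst r) r) at this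
  rw [Term.wk_inst, Term.wk_inst] at this
  exact this h

theorem congr_term {A B : S.Typ} {θ : Formula S Γ} (r : Term S (A :: Γ) B) {t s : Term S Γ A}
    (h : T.Entails θ (.eq t s)) : T.Entails θ (.eq (r.inst t) (r.inst s)) :=
  h.cut (eq_term r t s)

theorem congr_fst {A B : S.Typ} {θ : Formula S Γ} {t s : Term S Γ (.prod A B)}
    (h : T.Entails θ (.eq t s)) : T.Entails θ (.eq (.fst t) (.fst s)) :=
  congr_term (.fst (.var .zero)) h

theorem congr_snd {A B : S.Typ} {θ : Formula S Γ} {t s : Term S Γ (.prod A B)}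
    (h : T.Entails θ (.eq t s)) : T.Entails θ (.eq (.snd t) (.snd s)) :=
  congr_term (.snd (.var .zero)) h

theorem congr_app {A B : S.Typ} {θ : Formula S Γ} (f : S.Fun A B) {t s : Term S Γ A}
    (h : T.Entails θ (.eq t s)) : T.Entails θ (.eq (.app f t) (.app f s)) :=
  congr_term (.app f (.var .zero)) h

theorem congr_pair {A B : S.Typ} {θ : Formula S Γ} {t t' : Term S Γ A} {s s' : Term S Γ B}
    (h : T.Entails θ (.eq t t')) (h' : T.Entails θ (.eq s s')) :
    T.Entails θ (.eq (.pair t s) (.pair t' s')) := by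
  have h₁ := congr_term (.pair (.var .zero) (s.wk A)) h
  have h₂ := congr_term (.pair (t'.wk B) (.var .zero)) h'
  change T.Entails θ (.eq (.pair t ((s.wk A).inst t)) (.pair t' ((s.wk A).inst t'))) at h₁
  change T.Entails θ (.eq (.pair ((t'.wk B).inst s) s) (.pair ((t'.wk B).inst s') s')) at h₂
  rw [Term.wk_inst, Term.wk_inst] at h₁ h₂
  exact h₁.trans' h₂

theorem pair_ext {A B : S.Typ} {θ : Formula S Γ} {t s : Term S Γ (.prod A B)}
    (h : T.Entails θ (.eq (.fst t) (.fst s))) (h' : T.Entails θ (.eq (.snd t) (.snd s))) :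
    T.Entails θ (.eq t s) :=
  (of_top (pair_eta t)).symm'.trans' ((congr_pair h h').trans' (of_top (pair_eta s)))

theorem congr_subst {Δ : Ctx S} {A : S.Typ} {θ : Formula S Γ} {σ τ : Subst S Γ Δ}
    (h : ∀ (B : S.Typ) (x : Var Δ B), T.Entails θ (.eq (σ B x) (τ B x))) (t : Term S Δ A) :
    T.Entails θ (.eq (t.subst σ) (t.subst τ)) := by
  induction t with
  | var x => exact h _ x
  | app f t ih => exact congr_app f ih
  | pair t s ih ih' => exact congr_pair ih ih'
  | fst t ih => exact congr_fst ih
  | snd t ih => exact congr_snd ih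
  | star => exact refl' _

theorem replace {A B : S.Typ} {θ : Formula S Γ} (φ : Formula S [B, A]) {s s' : Term S Γ A}
    {t t' : Term S Γ B} (hs : T.Entails θ (.eq s s')) (ht : T.Entails θ (.eq t t'))
    (h : T.Entails θ (φ.at s t)) : T.Entails θ (φ.at s' t') := by
  have h₁ := subst_eq (φ.at (.var .zero) (t.wk A)) hs
  have h₂ := subst_eq (φ.at (s'.wk B) (.var .zero)) ht
  simp only [Formula.inst, Formula.at_subst, Term.wk_subst_cons] at h₁ h₂
  exact h₂ (h₁ h)

end Theory.Entails

/-! ### The classifying category -/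

/-- Equivalence of formulas in context: provable logical equivalence under the theory. -/
def Theory.setoid (T : Theory S) (Γ : Ctx S) : Setoid (Formula S Γ) where
  r φ ψ := T.Entails φ ψ ∧ T.Entails ψ φ
  iseqv := ⟨fun φ => ⟨.identity φ, .identity φ⟩, fun h => ⟨h.2, h.1⟩,
    fun h h' => ⟨h.1.cut h'.1, h'.2.cut h.2⟩⟩

/-- The classifying category of a theory. Its objects are the types (basic or compound). -/
def Cl (_T : Theory S) : Type u := S.Typ

namespace Cl

variable {T : Theory S}

/-- A morphism `A ⟶ B` of the classifying category is an equivalence class of formulas in context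
`x : A, y : B | φ`. -/
def Hom (T : Theory S) (A B : S.Typ) : Type (max u v) := Quotient (T.setoid [B, A])

/-- The morphism `[x : A, y : B | φ]`. -/
def mk {A B : S.Typ} (φ : Formula S [B, A]) : Hom T A B := Quotient.mk (T.setoid [B, A]) φ

/-- The first variable of the context `x : A, y : B`. -/
abbrev vx {A B : S.Typ} : Term S [B, A] A := .var (.succ .zero)

/-- The second variable of the context `x : A, y : B`. -/
abbrev vy {A B : S.Typ} : Term S [B, A] B := .var .zero

/-- The single variable of the context `x : A`. -/
abbrev v {A : S.Typ} : Term S [A] A := .var .zero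

/-- The formula `x : A, x' : A | x = x'`. -/
def idF (A : S.Typ) : Formula S [A, A] := .eq vx vy

/-- The formula `x : A, z : C | ∃ y : B, φ(x, y) ∧ ψ(y, z)`. -/
def compF {A B C : S.Typ} (φ : Formula S [B, A]) (ψ : Formula S [C, B]) : Formula S [C, A] :=
  .ex (A := B) (.and (φ.at (.var (.succ (.succ .zero))) (.var .zero))
    (ψ.at (.var .zero) (.var (.succ .zero))))

/-- The formula `x : A₁ × A₂, y : B₁ × B₂ | φ(π₁ x, π₁ y) ∧ ψ(π₂ x, π₂ y)`. -/
def tensorF {A₁ A₂ B₁ B₂ : S.Typ} (φ : Formula S [B₁, A₁]) (ψ : Formula S [B₂, A₂]) :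
    Formula S [.prod B₁ B₂, .prod A₁ A₂] :=
  .and (φ.at (.fst vx) (.fst vy)) (ψ.at (.snd vx) (.snd vy))

/-- The graph `x : A, y : B | t(x) = y` of a term `x : A | t : B`. -/
def graphF {A B : S.Typ} (t : Term S [A] B) : Formula S [B, A] := .eq (t.ap vx) vy

/-- The formula `x : A × B, y : B × A | (π₁ x = π₂ y) ∧ (π₂ x = π₁ y)`. -/
def braidF (A B : S.Typ) : Formula S [.prod B A, .prod A B] :=
  .and (.eq (.fst vx) (.snd vy)) (.eq (.snd vx) (.fst vy))

theorem ap_ap {Γ : Ctx S} {A B C : S.Typ} (t : Term S [B] C) (s : Term S [A] B)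
    (r : Term S Γ A) : (t.ap s).ap r = t.ap (s.ap r) := by
  simp only [Term.ap, Term.subst_subst, Subst.cons_comp]
  rw [Subst.eq_nil ((Subst.nil [A]).comp _)]

theorem ap_subst {Γ Δ : Ctx S} {A B : S.Typ} (t : Term S [A] B) (s : Term S Δ A)
    (σ : Subst S Γ Δ) : (t.ap s).subst σ = t.ap (s.subst σ) := by
  simp only [Term.ap, Term.subst_subst, Subst.cons_comp]
  rw [Subst.eq_nil ((Subst.nil Δ).comp _)]

theorem ap_v {A B : S.Typ} (t : Term S [A] B) : t.ap v = t := by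
  have : ((Subst.nil [A]).cons v : Subst S [A] [A]) = Subst.id [A] := by
    funext B x
    rcases x with _ | x
    · rfl
    · cases x
  rw [Term.ap, this, Term.subst_id]

theorem congr_ap {Γ : Ctx S} {A B : S.Typ} {θ : Formula S Γ} (t : Term S [A] B)
    {s s' : Term S Γ A} (h : T.Entails θ (.eq s s')) : T.Entails θ (.eq (t.ap s) (t.ap s')) := by
  refine Theory.Entails.congr_subst (fun B x => ?_) t
  rcases x with _ | x
  · exact h
  · cases x

theorem idF_at {Γ : Ctx S} {A : S.Typ} (s t : Term S Γ A) : (idF A).at s t = .eq s t := rfl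

theorem compF_at {Γ : Ctx S} {A B C : S.Typ} (φ : Formula S [B, A]) (ψ : Formula S [C, B])
    (s : Term S Γ A) (t : Term S Γ C) :
    (compF φ ψ).at s t =
      .ex (A := B) (.and (φ.at (s.wk B) (.var .zero)) (ψ.at (.var .zero) (t.wk B))) := by
  simp only [compF, Formula.at, Formula.subst, Formula.subst_subst, Subst.two_comp]
  rfl

theorem tensorF_at {Γ : Ctx S} {A₁ A₂ B₁ B₂ : S.Typ} (φ : Formula S [B₁, A₁])
    (ψ : Formula S [B₂, A₂]) (s : Term S Γ (.prod A₁ A₂)) (t : Term S Γ (.prod B₁ B₂)) :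
    (tensorF φ ψ).at s t =
      .and (φ.at (.fst s) (.fst t)) (ψ.at (.snd s) (.snd t)) := by
  simp only [tensorF, Formula.at, Formula.subst, Formula.subst_subst, Subst.two_comp]
  rfl

theorem graphF_at {Γ : Ctx S} {A B : S.Typ} (r : Term S [A] B) (s : Term S Γ A)
    (t : Term S Γ B) : (graphF r).at s t = .eq (r.ap s) t := by
  simp only [graphF, Formula.at, Formula.subst, ap_subst]
  rfl

theorem comp_intro {Γ : Ctx S} {A B C : S.Typ} {θ : Formula S Γ} {φ : Formula S [B, A]}
    {ψ : Formula S [C, B]} {s : Term S Γ A} {t : Term S Γ C} (r : Term S Γ B)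
    (h : T.Entails θ (φ.at s r)) (h' : T.Entails θ (ψ.at r t)) :
    T.Entails θ ((compF φ ψ).at s t) := by
  rw [compF_at]
  refine Theory.Entails.ex_intro r ?_
  simp only [Formula.inst, Formula.subst, Formula.at_subst, Term.wk_subst_cons]
  exact h.and_intro h'

theorem comp_elim {Γ : Ctx S} {A B C : S.Typ} {θ κ : Formula S Γ} {φ : Formula S [B, A]}
    {ψ : Formula S [C, B]} {s : Term S Γ A} {t : Term S Γ C}
    (h : T.Entails θ ((compF φ ψ).at s t))
    (h' : ∀ θ' : Formula S (B :: Γ), T.Entails θ' (θ.wk B) →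
      T.Entails θ' (φ.at (s.wk B) (.var .zero)) → T.Entails θ' (ψ.at (.var .zero) (t.wk B)) →
      T.Entails θ' (κ.wk B)) : T.Entails θ κ := by
  rw [compF_at] at h
  exact h.ex_elim (h' _ (.and_left _ _) (Theory.Entails.and_right _ _).left
    (Theory.Entails.and_right _ _).right)

/-- A sequent in the context `x : A, y : B` is checked on variables. -/
theorem entails_iff {A B : S.Typ} {φ ψ : Formula S [B, A]} :
    T.Entails φ ψ ↔ T.Entails (φ.at vx vy) (ψ.at vx vy) := by
  rw [Formula.at_vars, Formula.at_vars]

theorem entails_at {Γ : Ctx S} {A B : S.Typ} {θ : Formula S Γ} {φ ψ : Formula S [B, A]}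
    (h : T.Entails φ ψ) {s : Term S Γ A} {t : Term S Γ B} (h' : T.Entails θ (φ.at s t)) :
    T.Entails θ (ψ.at s t) :=
  h'.cut (h.substitution _)

theorem mk_eq {A B : S.Typ} {φ ψ : Formula S [B, A]}
    (h : T.Entails (φ.at vx vy) (ψ.at vx vy)) (h' : T.Entails (ψ.at vx vy) (φ.at vx vy)) :
    (mk φ : Hom T A B) = mk ψ :=
  Quotient.sound ⟨entails_iff.2 h, entails_iff.2 h'⟩

theorem compF_mono {A B C : S.Typ} {φ φ' : Formula S [B, A]} {ψ ψ' : Formula S [C, B]}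
    (h : T.Entails φ φ') (h' : T.Entails ψ ψ') : T.Entails (compF φ ψ) (compF φ' ψ') := by
  rw [entails_iff]
  refine comp_elim (.identity _) fun θ _ h₁ h₂ => ?_
  rw [Formula.at_wk]
  exact comp_intro _ (entails_at h h₁) (entails_at h' h₂)

theorem tensorF_mono {A₁ A₂ B₁ B₂ : S.Typ} {φ φ' : Formula S [B₁, A₁]}
    {ψ ψ' : Formula S [B₂, A₂]} (h : T.Entails φ φ') (h' : T.Entails ψ ψ') :
    T.Entails (tensorF φ ψ) (tensorF φ' ψ') :=
  (entails_at h (.and_left _ _)).and_intro (entails_at h' (.and_right _ _))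

/-- The 2-morphisms of the classifying category are the theorems of the theory. -/
instance homOrder (A B : S.Typ) : PartialOrder (Hom T A B) where
  le := Quotient.lift₂ (fun φ ψ => T.Entails φ ψ) fun _ _ _ _ h h' =>
    propext ⟨fun k => h.2.cut (k.cut h'.1), fun k => h.1.cut (k.cut h'.2)⟩
  le_refl := by
    rintro ⟨φ⟩
    exact Theory.Entails.identity φ
  le_trans := by
    rintro ⟨φ⟩ ⟨χ⟩ ⟨ψ⟩ h h'
    exact Theory.Entails.cut h h'
  le_antisymm := by
    rintro ⟨φ⟩ ⟨ψ⟩ h h'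
    exact Quotient.sound ⟨h, h'⟩

/-- Composition in the classifying category. -/
def comp {A B C : S.Typ} : Hom T A B → Hom T B C → Hom T A C :=
  Quotient.map₂ compF fun _ _ h _ _ h' => ⟨compF_mono h.1 h'.1, compF_mono h.2 h'.2⟩

/-- The monoidal product of morphisms of the classifying category. -/
def tensor {A₁ A₂ B₁ B₂ : S.Typ} : Hom T A₁ B₁ → Hom T A₂ B₂ →
    Hom T (.prod A₁ A₂) (.prod B₁ B₂) :=
  Quotient.map₂ tensorF fun _ _ h _ _ h' => ⟨tensorF_mono h.1 h'.1, tensorF_mono h.2 h'.2⟩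

theorem comp_mk {A B C : S.Typ} (φ : Formula S [B, A]) (ψ : Formula S [C, B]) :
    comp (mk φ : Hom T A B) (mk ψ) = mk (compF φ ψ) := rfl

theorem tensor_mk {A₁ A₂ B₁ B₂ : S.Typ} (φ : Formula S [B₁, A₁]) (ψ : Formula S [B₂, A₂]) :
    tensor (mk φ : Hom T A₁ B₁) (mk ψ) = mk (tensorF φ ψ) := rfl

theorem comp_assoc {A B C D : S.Typ} (f : Hom T A B) (g : Hom T B C) (h : Hom T C D) :
    comp (comp f g) h = comp f (comp g h) := by
  rcases f with ⟨φ⟩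
  rcases g with ⟨ψ⟩
  rcases h with ⟨χ⟩
  refine mk_eq (comp_elim (.identity _) fun θ _ h₁ h₂ => ?_)
    (comp_elim (.identity _) fun θ _ h₁ h₂ => ?_)
  · refine comp_elim h₁ fun θ' h₀ h₃ h₄ => ?_
    have h₂' := h₀.cut h₂.wk
    simp only [Formula.at_wk] at h₂' ⊢
    exact comp_intro _ h₃ (comp_intro _ h₄ h₂')
  · refine comp_elim h₂ fun θ' h₀ h₃ h₄ => ?_
    have h₁' := h₀.cut h₁.wk
    simp only [Formula.at_wk] at h₁' ⊢
    exact comp_intro _ (comp_intro _ h₁' h₃) h₄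

/-- The morphism given by the graph of a term. -/
def graph {A B : S.Typ} (t : Term S [A] B) : Hom T A B := mk (graphF t)

theorem graph_comp {A B C : S.Typ} (t : Term S [A] B) (φ : Formula S [C, B]) :
    comp (graph t) (mk φ : Hom T B C) = mk (φ.at (t.ap vx) vy) := by
  refine mk_eq (comp_elim (.identity _) fun θ _ h₁ h₂ => ?_) ?_
  · rw [graphF_at] at h₁
    rw [Formula.at_at, Formula.at_wk]
    simp only [Term.wk, ap_subst] at *
    exact .replace φ h₁.symm' (.refl' _) h₂
  · refine comp_intro (t.ap vx) ?_ ?_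
    · rw [graphF_at]
      exact .refl' _
    · rw [Formula.at_at, ap_subst]
      exact .identity _

theorem comp_graph {A B C : S.Typ} (t : Term S [B] C) (t' : Term S [C] B)
    (h : T.Entails .top (.eq (t'.ap t) v)) (h' : T.Entails .top (.eq (t.ap t') v))
    (φ : Formula S [B, A]) :
    comp (mk φ : Hom T A B) (graph t) = mk (φ.at vx (t'.ap vy)) := by
  refine mk_eq (comp_elim (.identity _) fun θ _ h₁ h₂ => ?_) ?_
  · rw [graphF_at] at h₂
    rw [Formula.at_at, Formula.at_wk]
    simp only [Term.wk, ap_subst] at *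
    refine .replace φ (.refl' _) ?_ h₁
    have h₃ := h.substitution ((Subst.nil [B, C, A]).cons (.var .zero))
    change T.Entails _ (.eq ((t'.ap t).ap _) _) at h₃
    rw [ap_ap] at h₃
    exact (Theory.Entails.of_top h₃).symm'.trans' (congr_ap t' h₂)
  · refine comp_intro (t'.ap vy) ?_ ?_
    · rw [Formula.at_at, ap_subst]
      exact .identity _
    · rw [graphF_at]
      have h₃ := h'.substitution ((Subst.nil [C, A]).cons vy)
      change T.Entails _ (.eq ((t.ap t').ap _) _) at h₃
      rw [ap_ap] at h₃
      exact .of_top h₃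

theorem graph_congr {A B : S.Typ} {t t' : Term S [A] B} (h : T.Entails .top (.eq t t')) :
    (graph t : Hom T A B) = graph t' := by
  have h₁ : T.Entails .top (.eq (t.ap (vx : Term S [B, A] A)) (t'.ap vx)) := h.substitution _
  refine mk_eq ?_ ?_ <;> rw [graphF_at, graphF_at]
  · exact (Theory.Entails.of_top h₁).symm'.trans' (.identity _)
  · exact (Theory.Entails.of_top h₁).trans' (.identity _)

theorem graph_comp_graph {A B C : S.Typ} (t : Term S [A] B) (s : Term S [B] C) :
    comp (graph t : Hom T A B) (graph s) = graph (s.ap t) := by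
  refine (graph_comp t (graphF s)).trans ?_
  rw [graphF_at, graph, graphF, ap_ap]

theorem graph_v (A : S.Typ) : (graph v : Hom T A A) = mk (idF A) := rfl

/-! ### Provable equality of terms -/

/-- Provable equality of terms. -/
def tmSetoid (T : Theory S) (Γ : Ctx S) (A : S.Typ) : Setoid (Term S Γ A) where
  r t s := T.Entails .top (.eq t s)
  iseqv := ⟨fun t => .eq_refl t, fun h => h.symm', fun h h' => h.trans' h'⟩

/-- Terms up to provable equality. -/
def Tq (T : Theory S) (Γ : Ctx S) (A : S.Typ) : Type (max u v) := Quotient (tmSetoid T Γ A)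

namespace Tq

variable {Γ : Ctx S} {A B : S.Typ}

variable (T) in
/-- The class of a term up to provable equality. -/
def of (t : Term S Γ A) : Tq T Γ A := Quotient.mk _ t

/-- Pairs of classes of terms. -/
def pair : Tq T Γ A → Tq T Γ B → Tq T Γ (.prod A B) :=
  Quotient.map₂ .pair fun _ _ h _ _ h' => Theory.Entails.congr_pair h h'

/-- First projection of classes of terms. -/
def fst : Tq T Γ (.prod A B) → Tq T Γ A := Quotient.map .fst fun _ _ h => h.congr_fst

/-- Second projection of classes of terms. -/
def snd : Tq T Γ (.prod A B) → Tq T Γ B := Quotient.map .snd fun _ _ h => h.congr_snd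

@[simp] theorem of_pair (t : Term S Γ A) (s : Term S Γ B) :
    of T (.pair t s) = pair (of T t) (of T s) := rfl

@[simp] theorem of_fst (t : Term S Γ (.prod A B)) : of T (.fst t) = fst (of T t) := rfl

@[simp] theorem of_snd (t : Term S Γ (.prod A B)) : of T (.snd t) = snd (of T t) := rfl

@[simp] theorem fst_pair (t : Tq T Γ A) (s : Tq T Γ B) : fst (pair t s) = t := by
  rcases t with ⟨t⟩
  rcases s with ⟨s⟩
  exact Quotient.sound (Theory.Entails.proj_fst t s)

@[simp] theorem snd_pair (t : Tq T Γ A) (s : Tq T Γ B) : snd (pair t s) = s := by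
  rcases t with ⟨t⟩
  rcases s with ⟨s⟩
  exact Quotient.sound (Theory.Entails.proj_snd t s)

@[simp] theorem pair_eta (t : Tq T Γ (.prod A B)) : pair (fst t) (snd t) = t := by
  rcases t with ⟨t⟩
  exact Quotient.sound (Theory.Entails.pair_eta t)

theorem pair_eq (t : Tq T Γ A) (s : Tq T Γ B) (r : Tq T Γ (.prod A B)) :
    pair t s = r ↔ t = fst r ∧ s = snd r := by
  constructor
  · rintro rfl
    simp
  · rintro ⟨rfl, rfl⟩
    simp

instance : Subsingleton (Tq T Γ .unit) where
  allEq := by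
    rintro ⟨t⟩ ⟨s⟩
    exact Quotient.sound ((Theory.Entails.singleton t).trans' (Theory.Entails.singleton s).symm')

theorem entails {t s : Term S Γ A} {θ : Formula S Γ} (h : of T t = of T s) :
    T.Entails θ (.eq t s) :=
  .of_top (Quotient.exact h)

theorem conv {t t' s s' : Term S Γ A} {θ : Formula S Γ} (h : T.Entails θ (.eq t s))
    (ht : of T t = of T t') (hs : of T s = of T s') : T.Entails θ (.eq t' s') :=
  (Tq.entails ht.symm).trans' (h.trans' (Tq.entails hs))

end Tq

theorem replace_of {Γ : Ctx S} {A B : S.Typ} {θ : Formula S Γ} (φ : Formula S [B, A])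
    {s s' : Term S Γ A} {t t' : Term S Γ B} (h : T.Entails θ (φ.at s t))
    (hs : Tq.of T s = Tq.of T s') (ht : Tq.of T t = Tq.of T t') :
    T.Entails θ (φ.at s' t') :=
  .replace φ (Tq.entails hs) (Tq.entails ht) h

@[simp] theorem pair_ap {Γ : Ctx S} {A B C : S.Typ} (t : Term S [A] B) (s : Term S [A] C)
    (r : Term S Γ A) : (Term.pair t s).ap r = .pair (t.ap r) (s.ap r) := rfl

@[simp] theorem fst_ap {Γ : Ctx S} {A B C : S.Typ} (t : Term S [A] (.prod B C))
    (r : Term S Γ A) : (Term.fst t).ap r = .fst (t.ap r) := rfl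

@[simp] theorem snd_ap {Γ : Ctx S} {A B C : S.Typ} (t : Term S [A] (.prod B C))
    (r : Term S Γ A) : (Term.snd t).ap r = .snd (t.ap r) := rfl

@[simp] theorem star_ap {Γ : Ctx S} {A : S.Typ} (r : Term S Γ A) :
    (Term.star : Term S [A] _).ap r = .star := rfl

@[simp] theorem v_ap {Γ : Ctx S} {A : S.Typ} (r : Term S Γ A) : (v : Term S [A] A).ap r = r := rfl

theorem graph_tensor_graph {A₁ A₂ B₁ B₂ : S.Typ} (t : Term S [A₁] B₁) (s : Term S [A₂] B₂) :
    tensor (graph t : Hom T A₁ B₁) (graph s) =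
      graph (.pair (t.ap (.fst v)) (s.ap (.snd v))) := by
  refine mk_eq ?_ ?_ <;> rw [tensorF_at, graphF_at, graphF_at, graphF_at, pair_ap, ap_ap, ap_ap]
  · exact .pair_ext ((Tq.entails (by simp)).trans' (Theory.Entails.and_left _ _))
      ((Tq.entails (by simp)).trans' (Theory.Entails.and_right _ _))
  · exact .and_intro ((Tq.entails (by simp)).trans' (Theory.Entails.identity _).congr_fst)
      ((Tq.entails (by simp)).trans' (Theory.Entails.identity _).congr_snd)

theorem graph_eq {A B : S.Typ} {t t' : Term S [A] B} (h : Tq.of T t = Tq.of T t') :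
    (graph t : Hom T A B) = graph t' :=
  graph_congr (Tq.entails h)

theorem comp_graph' {A B C : S.Typ} (t : Term S [B] C) (t' : Term S [C] B)
    (h : Tq.of T (t'.ap t) = Tq.of T v) (h' : Tq.of T (t.ap t') = Tq.of T v)
    (φ : Formula S [B, A]) :
    comp (mk φ : Hom T A B) (graph t) = mk (φ.at vx (t'.ap vy)) :=
  comp_graph t t' (Tq.entails h) (Tq.entails h') φ

theorem id_comp {A B : S.Typ} (f : Hom T A B) : comp (mk (idF A)) f = f := by
  rcases f with ⟨φ⟩
  refine (graph_comp v φ).trans ?_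
  rw [v_ap, Formula.at_vars]
  rfl

theorem comp_id {A B : S.Typ} (f : Hom T A B) : comp f (mk (idF B)) = f := by
  rcases f with ⟨φ⟩
  refine (comp_graph' v v rfl rfl φ).trans ?_
  rw [v_ap, Formula.at_vars]
  rfl

theorem tensor_id (A B : S.Typ) :
    tensor (mk (idF A) : Hom T A A) (mk (idF B)) = mk (idF (.prod A B)) := by
  rw [← graph_v, ← graph_v, graph_tensor_graph, ← graph_v]
  exact graph_eq (by simp)

theorem tensor_comp {A₁ A₂ A₃ B₁ B₂ B₃ : S.Typ} (f : Hom T A₁ A₂) (g : Hom T B₁ B₂)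
    (f' : Hom T A₂ A₃) (g' : Hom T B₂ B₃) :
    comp (tensor f g) (tensor f' g') = tensor (comp f f') (comp g g') := by
  rcases f with ⟨φ⟩
  rcases g with ⟨ψ⟩
  rcases f' with ⟨φ'⟩
  rcases g' with ⟨ψ'⟩
  refine mk_eq (comp_elim (.identity _) fun θ _ h₁ h₂ => ?_) ?_
  · rw [tensorF_at] at h₁ h₂
    rw [Formula.at_wk, tensorF_at]
    exact (comp_intro _ h₁.left h₂.left).and_intro (comp_intro _ h₁.right h₂.right)
  · rw [tensorF_at]
    refine comp_elim (Theory.Entails.and_left _ _) fun θ h₀ h₁ h₂ => ?_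
    have h₃ : T.Entails θ (((compF ψ ψ').at _ _).wk _) := h₀.right
    rw [Formula.at_wk] at h₃
    refine comp_elim h₃ fun θ' h₀' h₁' h₂' => ?_
    replace h₁ := h₀'.cut h₁.wk
    replace h₂ := h₀'.cut h₂.wk
    simp only [Formula.at_wk] at h₁ h₂ ⊢
    refine comp_intro (.pair (.wk _ (.var .zero)) (.var .zero)) ?_ ?_ <;> rw [tensorF_at]
    · exact .and_intro (replace_of φ h₁ rfl (by simp)) (replace_of ψ h₁' rfl (by simp))
    · exact .and_intro (replace_of φ' h₂ (by simp) rfl) (replace_of ψ' h₂' (by simp) rfl)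

/-- The term `⟨π₁ π₁ x, ⟨π₂ π₁ x, π₂ x⟩⟩`. -/
def assocTm (A B C : S.Typ) : Term S [.prod (.prod A B) C] (.prod A (.prod B C)) :=
  .pair (.fst (.fst v)) (.pair (.snd (.fst v)) (.snd v))

/-- The term `⟨⟨π₁ x, π₁ π₂ x⟩, π₂ π₂ x⟩`. -/
def assocInvTm (A B C : S.Typ) : Term S [.prod A (.prod B C)] (.prod (.prod A B) C) :=
  .pair (.pair (.fst v) (.fst (.snd v))) (.snd (.snd v))

/-- The term `π₂ x`. -/
def lunitTm (A : S.Typ) : Term S [.prod .unit A] A := .snd v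

/-- The term `⟨*, x⟩`. -/
def lunitInvTm (A : S.Typ) : Term S [A] (.prod .unit A) := .pair .star v

/-- The term `π₁ x`. -/
def runitTm (A : S.Typ) : Term S [.prod A .unit] A := .fst v

/-- The term `⟨x, *⟩`. -/
def runitInvTm (A : S.Typ) : Term S [A] (.prod A .unit) := .pair v .star

/-- The term `⟨π₂ x, π₁ x⟩`. -/
def swapTm (A B : S.Typ) : Term S [.prod A B] (.prod B A) := .pair (.snd v) (.fst v)

theorem assoc_inv (A B C : S.Typ) :
    Tq.of T ((assocInvTm A B C).ap (assocTm A B C)) = Tq.of T v := by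
  simp [assocTm, assocInvTm]

theorem inv_assoc (A B C : S.Typ) :
    Tq.of T ((assocTm A B C).ap (assocInvTm A B C)) = Tq.of T v := by
  simp [assocTm, assocInvTm]

theorem lunit_inv (A : S.Typ) : Tq.of T ((lunitInvTm A).ap (lunitTm A)) = Tq.of T v := by
  simp [lunitTm, lunitInvTm, Tq.pair_eq, eq_iff_true_of_subsingleton]

theorem inv_lunit (A : S.Typ) : Tq.of T ((lunitTm A).ap (lunitInvTm A)) = Tq.of T v := by
  simp [lunitTm, lunitInvTm]

theorem runit_inv (A : S.Typ) : Tq.of T ((runitInvTm A).ap (runitTm A)) = Tq.of T v := by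
  simp [runitTm, runitInvTm, Tq.pair_eq, eq_iff_true_of_subsingleton]

theorem inv_runit (A : S.Typ) : Tq.of T ((runitTm A).ap (runitInvTm A)) = Tq.of T v := by
  simp [runitTm, runitInvTm]

theorem swap_swap (A B : S.Typ) : Tq.of T ((swapTm B A).ap (swapTm A B)) = Tq.of T v := by
  simp [swapTm]

theorem associator_naturality {A₁ A₂ A₃ B₁ B₂ B₃ : S.Typ} (f : Hom T A₁ B₁) (g : Hom T A₂ B₂)
    (h : Hom T A₃ B₃) :
    comp (tensor (tensor f g) h) (graph (assocTm B₁ B₂ B₃)) =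
      comp (graph (assocTm A₁ A₂ A₃)) (tensor f (tensor g h)) := by
  rcases f with ⟨φ⟩
  rcases g with ⟨ψ⟩
  rcases h with ⟨χ⟩
  refine (comp_graph' (assocTm B₁ B₂ B₃) (assocInvTm B₁ B₂ B₃) (assoc_inv ..) (inv_assoc ..)
    (tensorF (tensorF φ ψ) χ)).trans (Eq.trans ?_
    (graph_comp (assocTm A₁ A₂ A₃) (tensorF φ (tensorF ψ χ))).symm)
  refine mk_eq ?_ ?_ <;> rw [Formula.at_at, Formula.at_at] <;> simp only [tensorF_at, ap_subst]
  · have h := fun (Γ : Ctx S) (κ : Formula S Γ) => Theory.Entails.identity (T := T) κ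
    exact .and_intro (replace_of φ (h _ _).left.left (by simp [assocTm]) (by simp [assocInvTm]))
      (.and_intro (replace_of ψ (h _ _).left.right (by simp [assocTm]) (by simp [assocInvTm]))
        (replace_of χ (h _ _).right (by simp [assocTm]) (by simp [assocInvTm])))
  · have h := fun (Γ : Ctx S) (κ : Formula S Γ) => Theory.Entails.identity (T := T) κ
    exact .and_intro (.and_intro
      (replace_of φ (h _ _).left (by simp [assocTm]) (by simp [assocInvTm]))
      (replace_of ψ (h _ _).right.left (by simp [assocTm]) (by simp [assocInvTm])))
      (replace_of χ (h _ _).right.right (by simp [assocTm]) (by simp [assocInvTm]))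

theorem leftUnitor_naturality {A B : S.Typ} (f : Hom T A B) :
    comp (tensor (mk (idF .unit)) f) (graph (lunitTm B)) = comp (graph (lunitTm A)) f := by
  rcases f with ⟨φ⟩
  refine (comp_graph' (lunitTm B) (lunitInvTm B) (lunit_inv B) (inv_lunit B)
    (tensorF (idF .unit) φ)).trans (Eq.trans ?_ (graph_comp (lunitTm A) φ).symm)
  refine mk_eq ?_ ?_ <;> rw [Formula.at_at, Formula.at_at] <;>
    simp only [tensorF_at, ap_subst, idF_at]
  · exact replace_of φ (Theory.Entails.identity _).right (by simp [lunitTm]) (by simp [lunitInvTm])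
  · exact .and_intro (Tq.entails (Subsingleton.elim _ _))
      (replace_of φ (Theory.Entails.identity _) (by simp [lunitTm]) (by simp [lunitInvTm]))

theorem rightUnitor_naturality {A B : S.Typ} (f : Hom T A B) :
    comp (tensor f (mk (idF .unit))) (graph (runitTm B)) = comp (graph (runitTm A)) f := by
  rcases f with ⟨φ⟩
  refine (comp_graph' (runitTm B) (runitInvTm B) (runit_inv B) (inv_runit B)
    (tensorF φ (idF .unit))).trans (Eq.trans ?_ (graph_comp (runitTm A) φ).symm)
  refine mk_eq ?_ ?_ <;> rw [Formula.at_at, Formula.at_at] <;>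
    simp only [tensorF_at, ap_subst, idF_at]
  · exact replace_of φ (Theory.Entails.identity _).left (by simp [runitTm]) (by simp [runitInvTm])
  · exact .and_intro
      (replace_of φ (Theory.Entails.identity _) (by simp [runitTm]) (by simp [runitInvTm]))
      (Tq.entails (Subsingleton.elim _ _))

theorem pentagon (A B C D : S.Typ) :
    comp (tensor (graph (assocTm A B C)) (mk (idF D)))
        (comp (graph (assocTm A (.prod B C) D)) (tensor (mk (idF A)) (graph (assocTm B C D)))) =
      comp (graph (assocTm (.prod A B) C D) : Hom T _ _) (graph (assocTm A B (.prod C D))) := by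
  simp only [← graph_v, graph_tensor_graph, graph_comp_graph]
  exact graph_eq (by simp [assocTm])

theorem triangle (A B : S.Typ) :
    comp (graph (assocTm A .unit B)) (tensor (mk (idF A)) (graph (lunitTm B))) =
      (tensor (graph (runitTm A)) (mk (idF B)) : Hom T _ _) := by
  simp only [← graph_v, graph_tensor_graph, graph_comp_graph]
  exact graph_eq (by simp [assocTm, lunitTm, runitTm])

theorem mk_braidF (A B : S.Typ) : (mk (braidF A B) : Hom T _ _) = graph (swapTm A B) := by
  refine mk_eq ?_ ?_ <;> rw [graphF_at]
  · have h : T.Entails ((braidF A B).at vx vy) (.and (.eq (.fst vx) (.snd vy))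
      (.eq (.snd vx) (.fst vy))) := .identity _
    exact .pair_ext ((Tq.entails (by simp [swapTm])).trans' h.right)
      ((Tq.entails (by simp [swapTm])).trans' h.left)
  · rw [Formula.at_vars]
    have h := fun (Γ : Ctx S) (κ : Formula S Γ) => Theory.Entails.identity (T := T) κ
    exact .and_intro ((Tq.entails (by simp [swapTm])).trans' (h _ _).congr_snd)
      ((Tq.entails (by simp [swapTm])).trans' (h _ _).congr_fst)

theorem braid_naturality {A B A' B' : S.Typ} (f : Hom T A A') (g : Hom T B B') :
    comp (tensor f g) (mk (braidF A' B')) = comp (mk (braidF A B)) (tensor g f) := by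
  rw [mk_braidF, mk_braidF]
  rcases f with ⟨φ⟩
  rcases g with ⟨ψ⟩
  refine (comp_graph' (swapTm A' B') (swapTm B' A') (swap_swap ..) (swap_swap ..)
    (tensorF φ ψ)).trans (Eq.trans ?_ (graph_comp (swapTm A B) (tensorF ψ φ)).symm)
  have h := fun (Γ : Ctx S) (κ : Formula S Γ) => Theory.Entails.identity (T := T) κ
  refine mk_eq ?_ ?_ <;> rw [Formula.at_at, Formula.at_at] <;> simp only [tensorF_at, ap_subst]
  · exact .and_intro (replace_of ψ (h _ _).right (by simp [swapTm]) (by simp [swapTm]))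
      (replace_of φ (h _ _).left (by simp [swapTm]) (by simp [swapTm]))
  · exact .and_intro (replace_of φ (h _ _).right (by simp [swapTm]) (by simp [swapTm]))
      (replace_of ψ (h _ _).left (by simp [swapTm]) (by simp [swapTm]))

/-- The diagonal `[x : A, y : A × A | ⟨x, x⟩ = y]`. -/
def copy (A : S.Typ) : Hom T A (.prod A A) := mk (.eq (.pair vx vx) vy)

/-- The deletion morphism `[x : A, y : 1 | ⊤]`. -/
def discard (A : S.Typ) : Hom T A .unit := mk .top

/-- The codiagonal `[x : A × A, y : A | x = ⟨y, y⟩]`. -/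
def mergeHom (A : S.Typ) : Hom T (.prod A A) A := mk (.eq vx (.pair vy vy))

/-- The creation morphism `[x : 1, y : A | ⊤]`. -/
def createHom (A : S.Typ) : Hom T .unit A := mk .top

theorem copy_eq (A : S.Typ) : (copy A : Hom T _ _) = graph (.pair v v) := rfl

theorem discard_eq (A : S.Typ) : (discard A : Hom T _ _) = graph .star := by
  refine mk_eq ?_ (.truth _)
  rw [graphF_at]
  exact Tq.entails (Subsingleton.elim _ _)

theorem mergeF_at {Γ : Ctx S} {A : S.Typ} (s : Term S Γ (.prod A A)) (t : Term S Γ A) :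
    (Formula.eq (vx : Term S [A, .prod A A] _) (.pair vy vy)).at s t = .eq s (.pair t t) := rfl

theorem copyF_at {Γ : Ctx S} {A : S.Typ} (s : Term S Γ A) (t : Term S Γ (.prod A A)) :
    (Formula.eq (.pair vx vx) (vy : Term S [.prod A A, A] _)).at s t = .eq (.pair s s) t := rfl

theorem topF_at {Γ : Ctx S} {A B : S.Typ} (s : Term S Γ A) (t : Term S Γ B) :
    (Formula.top : Formula S [B, A]).at s t = .top := rfl

theorem comp_mono {A B C : S.Typ} {f f' : Hom T A B} {g g' : Hom T B C} (h : f ≤ f')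
    (h' : g ≤ g') : comp f g ≤ comp f' g' := by
  rcases f with ⟨φ⟩
  rcases f' with ⟨φ'⟩
  rcases g with ⟨ψ⟩
  rcases g' with ⟨ψ'⟩
  exact compF_mono h h'

theorem tensor_mono {A B A' B' : S.Typ} {f f' : Hom T A B} {g g' : Hom T A' B'} (h : f ≤ f')
    (h' : g ≤ g') : tensor f g ≤ tensor f' g' := by
  rcases f with ⟨φ⟩
  rcases f' with ⟨φ'⟩
  rcases g with ⟨ψ⟩
  rcases g' with ⟨ψ'⟩
  exact tensorF_mono h h'

theorem mk_le {A B : S.Typ} {φ ψ : Formula S [B, A]}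
    (h : T.Entails (φ.at vx vy) (ψ.at vx vy)) : (mk φ : Hom T A B) ≤ mk ψ :=
  entails_iff.2 h

theorem lax_copy {A B : S.Typ} (f : Hom T A B) :
    comp f (copy B) ≤ comp (copy A) (tensor f f) := by
  rcases f with ⟨φ⟩
  refine mk_le (comp_elim (.identity _) fun θ _ h₁ h₂ => ?_)
  rw [copyF_at] at h₂
  rw [Formula.at_wk]
  refine comp_intro (.pair (.wk _ vx) (.wk _ vx)) ?_ ?_
  · rw [copyF_at]
    exact .refl' _
  · rw [tensorF_at]
    exact .and_intro
      (.replace φ (Tq.entails (by simp)) ((Tq.entails (by simp)).trans' h₂.congr_fst) h₁)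
      (.replace φ (Tq.entails (by simp)) ((Tq.entails (by simp)).trans' h₂.congr_snd) h₁)

theorem lax_discard {A B : S.Typ} (f : Hom T A B) : comp f (discard B) ≤ discard A := by
  rcases f with ⟨φ⟩
  exact mk_le (.truth _)

theorem copy_adj_unit (A : S.Typ) : (mk (idF A) : Hom T A A) ≤ comp (copy A) (mergeHom A) := by
  refine mk_le (comp_intro (.pair vx vx) ?_ ?_)
  · rw [copyF_at]
    exact .refl' _
  · rw [mergeF_at, idF_at]
    exact .congr_pair (.identity _) (.identity _)

theorem copy_adj_counit (A : S.Typ) :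
    comp (mergeHom A) (copy A) ≤ (mk (idF (.prod A A)) : Hom T _ _) := by
  refine mk_le (comp_elim (.identity _) fun θ _ h₁ h₂ => ?_)
  rw [mergeF_at] at h₁
  rw [copyF_at] at h₂
  rw [Formula.at_wk, idF_at]
  exact h₁.trans' h₂

theorem discard_adj_unit (A : S.Typ) :
    (mk (idF A) : Hom T A A) ≤ comp (discard A) (createHom A) :=
  mk_le (comp_intro .star (.truth _) (.truth _))

theorem discard_adj_counit (A : S.Typ) :
    comp (createHom A) (discard A) ≤ (mk (idF .unit) : Hom T _ _) :=
  mk_le (Tq.entails (Subsingleton.elim _ _))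

theorem merge_comp_copy (A : S.Typ) :
    (comp (mergeHom A) (copy A) : Hom T _ _) =
      mk (.and (.eq vx (.pair (.fst vx) (.fst vx))) (.eq vx vy)) := by
  refine mk_eq (comp_elim (.identity _) fun θ _ h₁ h₂ => ?_)
    (comp_intro (.fst vx) ?_ ?_)
  · rw [mergeF_at] at h₁
    rw [copyF_at] at h₂
    have h₃ := h₁.congr_fst.trans' (Tq.entails (s := .var .zero) (by simp))
    exact .and_intro (h₁.trans' (h₃.symm'.congr_pair h₃.symm')) (h₁.trans' h₂)
  · rw [mergeF_at]
    exact .and_left _ _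
  · rw [copyF_at]
    exact (Theory.Entails.and_left _ _).symm'.trans' (.and_right _ _)

theorem frobenius_left (A : S.Typ) :
    comp (tensor (mk (idF A)) (copy A)) (comp (graph (assocInvTm A A A))
        (tensor (mergeHom A) (mk (idF A)))) =
      (comp (mergeHom A) (copy A) : Hom T _ _) := by
  rw [merge_comp_copy, ← comp_assoc, copy_eq, ← graph_v, graph_tensor_graph, graph_comp_graph,
    graph_v]
  refine (graph_comp _ (tensorF _ (idF A))).trans (mk_eq ?_ ?_) <;>
    rw [Formula.at_at, tensorF_at, mergeF_at, idF_at, ap_subst]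
  · rw [Formula.at_vars]
    refine .assume fun θ h => ?_
    have h₁ : T.Entails θ (.eq (.fst vx) (.fst vy)) :=
      Tq.conv h.left.congr_fst (by simp [assocInvTm]) (by simp)
    have h₂ : T.Entails θ (.eq (.snd vx) (.fst vy)) :=
      Tq.conv h.left.congr_snd (by simp [assocInvTm]) (by simp)
    have h₃ : T.Entails θ (.eq (.snd vx) (.snd vy)) :=
      Tq.conv h.right (by simp [assocInvTm]) (by simp)
    exact .and_intro (.pair_ext (Tq.entails (by simp))
      (Tq.conv (h₂.trans' h₁.symm') rfl (by simp))) (h₁.pair_ext h₃)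
  · rw [Formula.at_vars]
    refine .assume fun θ h => ?_
    have h₁ : T.Entails θ (.eq (.snd vx) (.fst vx)) := Tq.conv h.left.congr_snd rfl (by simp)
    refine .and_intro (.pair_ext (Tq.conv h.right.congr_fst ?_ ?_)
      (Tq.conv (h₁.trans' h.right.congr_fst) ?_ ?_)) (Tq.conv h.right.congr_snd ?_ rfl) <;>
      simp [assocInvTm]

theorem frobenius_right (A : S.Typ) :
    comp (tensor (copy A) (mk (idF A))) (comp (graph (assocTm A A A))
        (tensor (mk (idF A)) (mergeHom A))) =
      (comp (mergeHom A) (copy A) : Hom T _ _) := by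
  rw [merge_comp_copy, ← comp_assoc, copy_eq, ← graph_v, graph_tensor_graph, graph_comp_graph,
    graph_v]
  refine (graph_comp _ (tensorF (idF A) _)).trans (mk_eq ?_ ?_) <;>
    rw [Formula.at_at, tensorF_at, mergeF_at, idF_at, ap_subst]
  · rw [Formula.at_vars]
    refine .assume fun θ h => ?_
    have h₁ : T.Entails θ (.eq (.fst vx) (.fst vy)) :=
      Tq.conv h.left (by simp [assocTm]) (by simp)
    have h₂ : T.Entails θ (.eq (.fst vx) (.snd vy)) :=
      Tq.conv h.right.congr_fst (by simp [assocTm]) (by simp)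
    have h₃ : T.Entails θ (.eq (.snd vx) (.snd vy)) :=
      Tq.conv h.right.congr_snd (by simp [assocTm]) (by simp)
    exact .and_intro (.pair_ext (Tq.entails (by simp))
      (Tq.conv (h₃.trans' h₂.symm') rfl (by simp))) (h₁.pair_ext h₃)
  · rw [Formula.at_vars]
    refine .assume fun θ h => ?_
    have h₁ : T.Entails θ (.eq (.snd vx) (.fst vx)) := Tq.conv h.left.congr_snd rfl (by simp)
    refine .and_intro (Tq.conv h.right.congr_fst ?_ rfl) (.pair_ext
      (Tq.conv (h₁.symm'.trans' h.right.congr_snd) ?_ ?_) (Tq.conv h.right.congr_snd ?_ ?_)) <;>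
      simp [assocTm]

/-! ### The classifying category is a bicategory of relations -/

instance : Category.{max u v} (Cl T) where
  Hom A B := Hom T A B
  id A := mk (idF A)
  comp f g := comp f g
  id_comp := id_comp
  comp_id := comp_id
  assoc := comp_assoc

/-- The isomorphism given by a pair of mutually inverse terms. -/
def graphIso {A B : Cl T} (t : Term S [A] B) (t' : Term S [B] A)
    (h : Tq.of T (t'.ap t) = Tq.of T v) (h' : Tq.of T (t.ap t') = Tq.of T v) : A ≅ B where
  hom := graph t
  inv := graph t'
  hom_inv_id := (graph_comp_graph t t').trans (graph_eq h)
  inv_hom_id := (graph_comp_graph t' t).trans (graph_eq h')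

instance : MonoidalCategoryStruct (Cl T) where
  tensorObj A B := Ty.prod A B
  tensorUnit := Ty.unit
  tensorHom f g := tensor f g
  whiskerLeft X _ _ f := tensor (mk (idF X)) f
  whiskerRight f X := tensor f (mk (idF X))
  associator A B C :=
    graphIso (assocTm A B C) (assocInvTm A B C) (assoc_inv A B C) (inv_assoc A B C)
  leftUnitor A := graphIso (lunitTm A) (lunitInvTm A) (lunit_inv A) (inv_lunit A)
  rightUnitor A := graphIso (runitTm A) (runitInvTm A) (runit_inv A) (inv_runit A)

instance : MonoidalCategory (Cl T) := .ofTensorHom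
  (id_tensorHom_id := tensor_id)
  (id_tensorHom := fun _ _ _ _ => rfl)
  (tensorHom_id := fun _ _ => rfl)
  (tensorHom_comp_tensorHom := tensor_comp)
  (associator_naturality := associator_naturality)
  (leftUnitor_naturality := leftUnitor_naturality)
  (rightUnitor_naturality := rightUnitor_naturality)
  (pentagon := pentagon)
  (triangle := triangle)

theorem hexagon_forward (A B C : S.Typ) :
    comp (graph (assocTm A B C)) (comp (mk (braidF A (.prod B C))) (graph (assocTm B C A))) =
      (comp (tensor (mk (braidF A B)) (mk (idF C))) (comp (graph (assocTm B A C))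
        (tensor (mk (idF B)) (mk (braidF A C)))) : Hom T _ _) := by
  simp only [← graph_v, mk_braidF, graph_tensor_graph, graph_comp_graph]
  exact graph_eq (by simp [assocTm, swapTm])

theorem hexagon_reverse (A B C : S.Typ) :
    comp (graph (assocInvTm A B C)) (comp (mk (braidF (.prod A B) C))
        (graph (assocInvTm C A B))) =
      (comp (tensor (mk (idF A)) (mk (braidF B C))) (comp (graph (assocInvTm A C B))
        (tensor (mk (braidF A C)) (mk (idF B)))) : Hom T _ _) := by
  simp only [← graph_v, mk_braidF, graph_tensor_graph, graph_comp_graph]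
  exact graph_eq (by simp [assocInvTm, swapTm])

theorem braid_braid (A B : S.Typ) :
    comp (mk (braidF A B)) (mk (braidF B A)) = (mk (idF (.prod A B)) : Hom T _ _) := by
  simp only [← graph_v, mk_braidF, graph_comp_graph]
  exact graph_eq (by simp [swapTm])

instance : SymmetricCategory (Cl T) where
  braiding A B := ⟨mk (braidF A B), mk (braidF B A), braid_braid A B, braid_braid B A⟩
  braiding_naturality_left f X := braid_naturality f (mk (idF X))
  braiding_naturality_right X _ _ f := braid_naturality (mk (idF X)) f
  hexagon_forward := hexagon_forward
  hexagon_reverse := hexagon_reverse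
  symmetry := braid_braid

theorem discard_copy (A : S.Typ) :
    comp (copy A) (tensor (discard A) (mk (idF A))) = (graph (lunitInvTm A) : Hom T _ _) := by
  simp only [← graph_v, copy_eq, discard_eq, graph_tensor_graph, graph_comp_graph]
  exact graph_eq (by simp [lunitInvTm])

theorem copy_discard (A : S.Typ) :
    comp (copy A) (tensor (mk (idF A)) (discard A)) = (graph (runitInvTm A) : Hom T _ _) := by
  simp only [← graph_v, copy_eq, discard_eq, graph_tensor_graph, graph_comp_graph]
  exact graph_eq (by simp [runitInvTm])

theorem copy_assoc (A : S.Typ) :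
    comp (copy A) (tensor (mk (idF A)) (copy A)) =
      (comp (copy A) (comp (tensor (copy A) (mk (idF A))) (graph (assocTm A A A))) :
        Hom T _ _) := by
  simp only [← graph_v, copy_eq, graph_tensor_graph, graph_comp_graph]
  exact graph_eq (by simp [assocTm])

theorem copy_comm (A : S.Typ) : comp (copy A) (mk (braidF A A)) = (copy A : Hom T _ _) := by
  simp only [copy_eq, mk_braidF, graph_comp_graph]
  exact graph_eq (by simp [swapTm])

theorem copy_tensor (A B : S.Typ) :
    (copy (.prod A B) : Hom T _ _) =
      comp (tensor (copy A) (copy B)) (comp (graph (assocTm A A (.prod B B)))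
        (comp (tensor (mk (idF A)) (graph (assocInvTm A B B)))
        (comp (tensor (mk (idF A)) (tensor (mk (braidF A B)) (mk (idF B))))
        (comp (tensor (mk (idF A)) (graph (assocTm B A B)))
          (graph (assocInvTm A B (.prod A B))))))) := by
  simp only [← graph_v, copy_eq, mk_braidF, graph_tensor_graph, graph_comp_graph]
  exact graph_eq (by simp [swapTm, assocTm, assocInvTm])

theorem discard_tensor (A B : S.Typ) :
    (discard (.prod A B) : Hom T _ _) =
      comp (tensor (discard A) (discard B)) (graph (lunitTm .unit)) := by
  simp only [discard_eq, graph_tensor_graph, graph_comp_graph]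
  exact graph_eq (Subsingleton.elim _ _)

theorem copy_unit : (copy .unit : Hom T _ _) = graph (lunitInvTm .unit) := by
  rw [copy_eq]
  exact graph_eq (by simp [lunitInvTm, Tq.pair_eq, eq_iff_true_of_subsingleton])

theorem discard_unit : (discard .unit : Hom T _ _) = mk (idF .unit) := by
  rw [discard_eq, ← graph_v]
  exact graph_eq (Subsingleton.elim _ _)

instance (A : Cl T) : ComonObj A where
  comul := copy A
  counit := discard A
  counit_comul := discard_copy A
  comul_counit := copy_discard A
  comul_assoc := copy_assoc A

instance (A : Cl T) : IsCommComonObj A where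
  comul_comm := copy_comm A

instance : CopyDiscardCategory (Cl T) where
  copy_tensor := copy_tensor
  discard_tensor := discard_tensor
  copy_unit := copy_unit
  discard_unit := discard_unit

instance : BicategoryOfRelations (Cl T) where
  homOrder A B := Cl.homOrder A B
  comp_mono := comp_mono
  tensor_mono := tensor_mono
  lax_copy := lax_copy
  lax_discard := lax_discard
  merge := mergeHom
  create := createHom
  copy_adj_unit := copy_adj_unit
  copy_adj_counit := copy_adj_counit
  discard_adj_unit := discard_adj_unit
  discard_adj_counit := discard_adj_counit
  frobenius_left := frobenius_left
  frobenius_right := frobenius_right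

end Cl

/-! ### Interpretations and the internal language -/

section

open ComonObj BicategoryOfRelations

variable {B : Type u₁} [Category.{v₁} B] [MonoidalCategory.{v₁} B]

/-- The extension of an interpretation of the basic types to all types. -/
def Ty.eval {C : Type u} (obj : C → B) : Ty C → B
  | .basic c => obj c
  | .prod A A' => A.eval obj ⊗ A'.eval obj
  | .unit => 𝟙_ B

variable [BicategoryOfRelations B]

variable (S B) in
/-- An interpretation of a signature in a bicategory of relations. Function symbols are interpreted
as maps. -/
structure Interpretation where
  obj : S.BasicType → B
  fn {A A' : S.Typ} : S.Fun A A' → (A.eval obj ⟶ A'.eval obj)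
  isMap_fn {A A' : S.Typ} (f : S.Fun A A') : IsMap (fn f)
  rel {A A' : S.Typ} : S.Rel A A' → (A.eval obj ⟶ A'.eval obj)

namespace Interpretation

variable (M : Interpretation S B)

/-- The interpretation of a type. -/
def typ (A : S.Typ) : B := A.eval M.obj

/-- The interpretation of a context is the product of the interpretations of its types. -/
def ctx : Ctx S → B
  | [] => 𝟙_ B
  | A :: Γ => ctx Γ ⊗ M.typ A

/-- The interpretation of a variable deletes all the other variables. -/
def var : {Γ : Ctx S} → {A : S.Typ} → Var Γ A → (M.ctx Γ ⟶ M.typ A)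
  | A :: Γ, _, .zero => ε[M.ctx Γ] ▷ M.typ A ≫ (λ_ (M.typ A)).hom
  | A :: Γ, _, .succ x => M.ctx Γ ◁ ε[M.typ A] ≫ (ρ_ (M.ctx Γ)).hom ≫ var x

/-- The interpretation of a term in context `Γ | t : A`. -/
def term {Γ : Ctx S} : {A : S.Typ} → Term S Γ A → (M.ctx Γ ⟶ M.typ A)
  | _, .var x => M.var x
  | _, .app f t => term t ≫ M.fn f
  | _, .pair t s => Δ[M.ctx Γ] ≫ (term t ⊗ₘ term s)
  | _, .fst (A := A) (B := A') t => term t ≫ M.typ A ◁ ε[M.typ A'] ≫ (ρ_ (M.typ A)).hom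
  | _, .snd (A := A) (B := A') t => term t ≫ ε[M.typ A] ▷ M.typ A' ≫ (λ_ (M.typ A')).hom
  | _, .star => ε[M.ctx Γ]

/-- The interpretation of a formula in context `Γ | φ`, with all the variables on the side of the
domain. In the clause for the existential quantifier the last variable is moved to the codomain
and then deleted. -/
def formula : {Γ : Ctx S} → Formula S Γ → (M.ctx Γ ⟶ 𝟙_ B)
  | Γ, .rel (B := A') R t s =>
      Δ[M.ctx Γ] ≫ ((M.term t ≫ M.rel R) ⊗ₘ M.term s) ≫ cap (M.typ A')
  | Γ, .eq (A := A) t s => Δ[M.ctx Γ] ≫ (M.term t ⊗ₘ M.term s) ≫ cap (M.typ A)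
  | Γ, .top => ε[M.ctx Γ]
  | Γ, .and φ ψ => Δ[M.ctx Γ] ≫ (formula φ ⊗ₘ formula ψ) ≫ merge (𝟙_ B)
  | Γ, .ex (A := A) φ => bend (X := M.ctx Γ) (Y := M.typ A) (formula φ) ≫ ε[M.typ A]

end Interpretation

section

variable (B)

/-- The signature of the internal language: a basic type for every object, a function symbol for
every map and a relation symbol for every morphism between interpretations of types. -/
def langSignature : Signature.{u₁, v₁} where
  BasicType := B
  Fun A A' := {f : A.eval (fun X : B => X) ⟶ A'.eval (fun X : B => X) // IsMap f}
  Rel A A' := A.eval (fun X : B => X) ⟶ A'.eval (fun X : B => X)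

/-- The obvious interpretation of the signature of the internal language. -/
def langInterpretation : Interpretation (langSignature B) B where
  obj X := X
  fn f := f.1
  isMap_fn f := f.2
  rel R := R

/-- The internal language of a bicategory of relations: its axioms are all the sequents
`Γ | φ ⊢ ψ` whose interpretations satisfy `⟦Γ | φ⟧ ≤ ⟦Γ | ψ⟧`. -/
def Lang : Theory (langSignature B) where
  Axiom _ φ ψ := (langInterpretation B).formula φ ≤ (langInterpretation B).formula ψ

end

end

end RegularLogic

namespace BicategoryOfRelations

open ComonObj

variable {C : Type u} [Category.{v} C] [MonoidalCategory.{v} C] [BicategoryOfRelations C]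

/-! ### Right adjoints and maps -/

/-! The equivalence is the functor `Cl (Lang B) ⥤ B` that evaluates a type as an object and sends a
class `[x, y | φ]` to the interpretation of `φ` with the wire of `y` bent to the codomain. Three of
its properties are immediate from the choice of language. It is surjective on objects, since every
object is a basic type. It is full, since every morphism `R` is itself a relation symbol and `R(x,
y)` is sent to `R`. It is faithful and reflects the order, since bending is invertible and monotone
in both directions and every inequality between interpretations is an axiom of `Lang B`.

The work lies in well-definedness (soundness) and in compatibility with the structure. Maps are
comonoid homomorphisms, because `Δ` and `ε` are lax natural for a map and for its right adjoint.
Hence terms are deterministic, tensor products behave as cartesian products for them, and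
substitution is precomposition. Formulas are then handled with three operations: `lift` (pairing),
`act` (restriction along a predicate, which is the meet when applied to predicates) and
precomposition with `coproj` (the right adjoint of a projection). The last is left adjoint to
weakening, so it satisfies the rules of the existential quantifier; Frobenius reciprocity and the
Beck-Chevalley law come from interchange and the comonoid laws. Equality is `cap`, and the Frobenius
equation gives `act_lift_cap_right`: restricting `w` to the locus `u = w` is the merge of `u` and
`w`. As merging is commutative, `u` and `w` may be exchanged there, which is the Leibniz rule.

The same calculus computes the bent form of `∃ y, φ ∧ ψ` as a composite and those of the structural
terms as the structural isomorphisms, so the functor is strictly monoidal. Finally, the inverse of a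
monoidal equivalence is monoidal through the adjunction; it preserves the order because the functor
reflects it, and the diagonals because the counit consists of isomorphisms, which are deterministic.
-/

instance {X Y Z : C} (f : X ⟶ Y) (g : Y ⟶ Z) [Deterministic f] [Deterministic g] :
    Deterministic (f ≫ g) := inferInstance

/-- `g ≤ g ≫ f ≫ g' ≤ g'`, and symmetrically. Every identity about `merge` and `coproj` that has no
direct proof is obtained by exhibiting two right adjoints of one morphism. -/
theorem right_adjoint_unique {X Y : C} {f : X ⟶ Y} {g g' : Y ⟶ X} (h₁ : 𝟙 X ≤ f ≫ g)
    (h₂ : g ≫ f ≤ 𝟙 Y) (h₁' : 𝟙 X ≤ f ≫ g') (h₂' : g' ≫ f ≤ 𝟙 Y) : g = g' := by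
  have key : ∀ {g g' : Y ⟶ X}, g ≫ f ≤ 𝟙 Y → 𝟙 X ≤ f ≫ g' → g ≤ g' := fun {g g'} h h' => by
    have h₁ := comp_mono (le_refl g) h'
    have h₂ := comp_mono h (le_refl g')
    rw [Category.comp_id, ← Category.assoc] at h₁
    rw [Category.id_comp] at h₂
    exact h₁.trans h₂
  exact le_antisymm (key h₂ h₁') (key h₂' h₁)

theorem adj_comp {X Y Z : C} {f : X ⟶ Y} {g : Y ⟶ X} {f' : Y ⟶ Z} {g' : Z ⟶ Y}
    (h₁ : 𝟙 X ≤ f ≫ g) (h₂ : g ≫ f ≤ 𝟙 Y) (h₁' : 𝟙 Y ≤ f' ≫ g') (h₂' : g' ≫ f' ≤ 𝟙 Z) :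
    𝟙 X ≤ (f ≫ f') ≫ g' ≫ g ∧ (g' ≫ g) ≫ f ≫ f' ≤ 𝟙 Z := by
  constructor
  · refine h₁.trans ?_
    have := comp_mono (le_refl f) (comp_mono h₁' (le_refl g))
    simpa using this
  · refine le_trans ?_ h₂'
    have := comp_mono (le_refl g') (comp_mono h₂ (le_refl f'))
    simpa using this

theorem isMap_iso {X Y : C} (f : X ≅ Y) : IsMap f.hom :=
  ⟨f.inv, by simp, by simp⟩

theorem isMap_copy (X : C) : IsMap Δ[X] := ⟨_, copy_adj_unit X, copy_adj_counit X⟩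

theorem isMap_discard (X : C) : IsMap ε[X] := ⟨_, discard_adj_unit X, discard_adj_counit X⟩

theorem whiskerLeft_mono (Z : C) {X Y : C} {f g : X ⟶ Y} (h : f ≤ g) : Z ◁ f ≤ Z ◁ g := by
  rw [← id_tensorHom, ← id_tensorHom]
  exact tensor_mono le_rfl h

theorem deterministic_of {X Y : C} {f : X ⟶ Y} (h : f ≫ ε[Y] = ε[X])
    (h' : f ≫ Δ[Y] = Δ[X] ≫ (f ⊗ₘ f)) : Deterministic f := ⟨h, h'⟩

theorem deterministic_comp {X Y Z : C} {f : X ⟶ Y} {g : Y ⟶ Z} (_ : Deterministic f)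
    (_ : Deterministic g) : Deterministic (f ≫ g) := inferInstance

/-- Maps are comonoid homomorphisms. -/
theorem IsMap.deterministic {X Y : C} {f : X ⟶ Y} (hf : IsMap f) : Deterministic f := by
  obtain ⟨g, h₁, h₂⟩ := hf
  constructor
  · refine le_antisymm (lax_discard f) ?_
    -- The converse inequality uses the lax law of the right adjoint: `ε ≤ f ≫ g ≫ ε ≤ f ≫ ε`.
    have h₃ := comp_mono h₁ (le_refl ε[X])
    rw [Category.id_comp, Category.assoc] at h₃
    exact h₃.trans (comp_mono le_rfl (lax_discard g))
  · refine le_antisymm (lax_copy f) ?_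
    -- Likewise `Δ ≫ (f ⊗ f) ≤ f ≫ g ≫ Δ ≫ (f ⊗ f) ≤ f ≫ Δ ≫ (gf ⊗ gf) ≤ f ≫ Δ`.
    have h₃ := comp_mono h₁ (le_refl (Δ[X] ≫ (f ⊗ₘ f)))
    rw [Category.id_comp, Category.assoc] at h₃
    refine h₃.trans (comp_mono le_rfl ?_)
    have h₄ := comp_mono (lax_copy g) (le_refl (f ⊗ₘ f))
    have h₅ := comp_mono (le_refl Δ[Y]) (tensor_mono h₂ h₂)
    rw [Category.assoc] at h₄
    rw [← tensorHom_comp_tensorHom, id_tensorHom_id, Category.comp_id] at h₅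
    rw [Category.assoc] at h₄
    exact h₄.trans h₅

instance (X : C) : Deterministic Δ[X] := (isMap_copy X).deterministic

instance (X : C) : Deterministic ε[X] := (isMap_discard X).deterministic

instance {X Y : C} (f : X ⟶ Y) [IsIso f] : Deterministic f := (isMap_iso (asIso f)).deterministic

instance {X Y X' Y' : C} (f : X ⟶ Y) (g : X' ⟶ Y') [Deterministic f] [Deterministic g] :
    Deterministic (f ⊗ₘ g) := by
  refine deterministic_of ?_ ?_
  · rw [CopyDiscardCategory.discard_tensor, CopyDiscardCategory.discard_tensor,
      tensorHom_comp_tensorHom_assoc, Deterministic.discard_natural f,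
      Deterministic.discard_natural g]
  · rw [CopyDiscardCategory.copy_tensor, CopyDiscardCategory.copy_tensor,
      tensorHom_comp_tensorHom_assoc, Deterministic.copy_natural f,
      Deterministic.copy_natural g, ← tensorHom_comp_tensorHom, Category.assoc, Category.assoc,
      tensorμ_natural]

instance (Z : C) {X Y : C} (f : X ⟶ Y) [Deterministic f] : Deterministic (Z ◁ f) := by
  rw [← id_tensorHom]
  infer_instance

instance (Z : C) {X Y : C} (f : X ⟶ Y) [Deterministic f] : Deterministic (f ▷ Z) := by
  rw [← tensorHom_id]
  infer_instance

/-! ### Pairing and projections -/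

/-- The pairing of two morphisms with the same domain. -/
def lift {X Y Z : C} (f : X ⟶ Y) (g : X ⟶ Z) : X ⟶ Y ⊗ Z := Δ[X] ≫ (f ⊗ₘ g)

/-- The first projection. -/
def fst (X Y : C) : X ⊗ Y ⟶ X := X ◁ ε[Y] ≫ (ρ_ X).hom

/-- The second projection. -/
def snd (X Y : C) : X ⊗ Y ⟶ Y := ε[X] ▷ Y ≫ (λ_ Y).hom

instance (X Y : C) : Deterministic (fst X Y) := by
  unfold fst
  infer_instance

instance (X Y : C) : Deterministic (snd X Y) := by
  unfold snd
  infer_instance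

instance {X Y Z : C} (f : X ⟶ Y) (g : X ⟶ Z) [Deterministic f] [Deterministic g] :
    Deterministic (lift f g) := by
  unfold lift
  infer_instance

section

variable {W X Y Z : C}

theorem lift_mono {f f' : X ⟶ Y} {g g' : X ⟶ Z} (h : f ≤ f') (h' : g ≤ g') :
    lift f g ≤ lift f' g' :=
  comp_mono le_rfl (tensor_mono h h')

/-- Only a comonoid homomorphism can be pushed through the copying inside a pairing; `g` and `h` are
arbitrary relations. -/
theorem comp_lift (f : W ⟶ X) [Deterministic f] (g : X ⟶ Y) (h : X ⟶ Z) :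
    f ≫ lift g h = lift (f ≫ g) (f ≫ h) := by
  simp [lift, tensorHom_comp_tensorHom]

theorem comp_lift_assoc (f : W ⟶ X) [Deterministic f] (g : X ⟶ Y) (h : X ⟶ Z) {V : C}
    (k : Y ⊗ Z ⟶ V) :
    f ≫ lift g h ≫ k = lift (f ≫ g) (f ≫ h) ≫ k := by
  rw [← comp_lift, Category.assoc]

@[simp]
theorem lift_tensorHom {Y' Z' : C} (f : X ⟶ Y) (g : X ⟶ Z) (h : Y ⟶ Y') (k : Z ⟶ Z') :
    lift f g ≫ (h ⊗ₘ k) = lift (f ≫ h) (g ≫ k) := by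
  simp [lift, tensorHom_comp_tensorHom]

@[simp]
theorem lift_tensorHom_assoc {Y' Z' : C} (f : X ⟶ Y) (g : X ⟶ Z) (h : Y ⟶ Y') (k : Z ⟶ Z')
    {V : C} (l : Y' ⊗ Z' ⟶ V) :
    lift f g ≫ (h ⊗ₘ k) ≫ l = lift (f ≫ h) (g ≫ k) ≫ l := by
  rw [← lift_tensorHom, Category.assoc]

@[simp]
theorem lift_whiskerLeft {Z' : C} (f : X ⟶ Y) (g : X ⟶ Z) (k : Z ⟶ Z') :
    lift f g ≫ (Y ◁ k) = lift f (g ≫ k) := by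
  rw [← id_tensorHom, lift_tensorHom, Category.comp_id]

@[simp]
theorem lift_whiskerLeft_assoc {Z' : C} (f : X ⟶ Y) (g : X ⟶ Z) (k : Z ⟶ Z') {V : C}
    (l : Y ⊗ Z' ⟶ V) :
    lift f g ≫ Y ◁ k ≫ l = lift f (g ≫ k) ≫ l := by
  rw [← lift_whiskerLeft, Category.assoc]

@[simp]
theorem lift_whiskerRight {Y' : C} (f : X ⟶ Y) (g : X ⟶ Z) (h : Y ⟶ Y') :
    lift f g ≫ (h ▷ Z) = lift (f ≫ h) g := by
  rw [← tensorHom_id, lift_tensorHom, Category.comp_id]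

@[simp]
theorem lift_whiskerRight_assoc {Y' : C} (f : X ⟶ Y) (g : X ⟶ Z) (h : Y ⟶ Y') {V : C}
    (l : Y' ⊗ Z ⟶ V) :
    lift f g ≫ h ▷ Z ≫ l = lift (f ≫ h) g ≫ l := by
  rw [← lift_whiskerRight, Category.assoc]

@[simp]
theorem lift_discard_right (f : X ⟶ Y) : lift f ε[X] ≫ (ρ_ Y).hom = f := by
  simp [lift]

@[simp]
theorem lift_discard_left (f : X ⟶ Y) : lift ε[X] f ≫ (λ_ Y).hom = f := by
  simp [lift]

-- Only the deleted component has to be total, so `f` may be any relation.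
@[simp]
theorem lift_fst (f : X ⟶ Y) (g : X ⟶ Z) [Deterministic g] : lift f g ≫ fst Y Z = f := by
  simp [fst]

@[simp]
theorem lift_fst_assoc (f : X ⟶ Y) (g : X ⟶ Z) [Deterministic g] {V : C} (k : Y ⟶ V) :
    lift f g ≫ fst Y Z ≫ k = f ≫ k := by
  rw [← Category.assoc, lift_fst]

@[simp]
theorem lift_snd (f : X ⟶ Y) (g : X ⟶ Z) [Deterministic f] : lift f g ≫ snd Y Z = g := by
  simp [snd]

@[simp]
theorem lift_braiding (f : X ⟶ Y) (g : X ⟶ Z) : lift f g ≫ (β_ Y Z).hom = lift g f := by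
  rw [lift, Category.assoc, BraidedCategory.braiding_naturality, IsCommComonObj.comul_comm_assoc,
    lift]

@[simp]
theorem lift_associator (f : X ⟶ W) (g : X ⟶ Y) (h : X ⟶ Z) :
    lift (lift f g) h ≫ (α_ W Y Z).hom = lift f (lift g h) := by
  have h₁ : lift (lift f g) h = Δ[X] ≫ Δ[X] ▷ X ≫ ((f ⊗ₘ g) ⊗ₘ h) := by
    rw [lift, lift, ← tensorHom_id, tensorHom_comp_tensorHom, Category.id_comp]
  have h₂ : lift f (lift g h) = Δ[X] ≫ X ◁ Δ[X] ≫ (f ⊗ₘ (g ⊗ₘ h)) := by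
    rw [lift, lift, ← id_tensorHom, tensorHom_comp_tensorHom, Category.id_comp]
  rw [h₁, h₂, Category.assoc, Category.assoc, associator_naturality, comul_assoc_assoc]

@[simp]
theorem lift_associator_inv (f : X ⟶ W) (g : X ⟶ Y) (h : X ⟶ Z) :
    lift f (lift g h) ≫ (α_ W Y Z).inv = lift (lift f g) h := by
  rw [← lift_associator, Category.assoc, Iso.hom_inv_id, Category.comp_id]

@[simp]
theorem lift_associator_inv_assoc (f : X ⟶ W) (g : X ⟶ Y) (h : X ⟶ Z) {V : C}
    (k : (W ⊗ Y) ⊗ Z ⟶ V) :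
    lift f (lift g h) ≫ (α_ W Y Z).inv ≫ k = lift (lift f g) h ≫ k := by
  rw [← lift_associator_inv, Category.assoc]

/-- The copy of `X ⊗ Y` is a middle-four shuffle of two copies; the projections delete the two inner
factors, and what is left is the counit law on each side. -/
theorem lift_fst_snd (X Y : C) : lift (fst X Y) (snd X Y) = 𝟙 (X ⊗ Y) := by
  -- Shuffling two units past each other is pure coherence.
  have h : tensorμ X (𝟙_ C) (𝟙_ C) Y = ((ρ_ X).hom ⊗ₘ (λ_ Y).hom) ≫
      ((ρ_ X).inv ⊗ₘ (λ_ Y).inv) := by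
    simp only [tensorμ, braiding_tensorUnit_left]
    monoidal
  have h₁ : ((X ◁ ε[X]) ⊗ₘ (ε[Y] ▷ Y)) ≫ tensorμ X (𝟙_ C) (𝟙_ C) Y =
      tensorμ X X Y Y ≫ ((X ◁ ε[Y]) ⊗ₘ (ε[X] ▷ Y)) := by
    have := tensorμ_natural (𝟙 X) ε[X] ε[Y] (𝟙 Y)
    simpa using this
  rw [lift, fst, snd, ← tensorHom_comp_tensorHom, CopyDiscardCategory.copy_tensor,
    Category.assoc, ← reassoc_of% h₁, h, tensorHom_comp_tensorHom_assoc]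
  simp [tensorHom_comp_tensorHom]

theorem lift_id_id (X : C) : lift (𝟙 X) (𝟙 X) = Δ[X] := by
  simp [lift]

theorem comp_copy (f : X ⟶ Y) [Deterministic f] : f ≫ Δ[Y] = lift f f :=
  Deterministic.copy_natural f

theorem whiskerRight_eq_lift (f : X ⟶ Y) : f ▷ Z = lift (fst X Z ≫ f) (snd X Z) := by
  rw [← lift_whiskerRight, lift_fst_snd, Category.id_comp]

theorem whiskerLeft_eq_lift (f : X ⟶ Y) : Z ◁ f = lift (fst Z X) (snd Z X ≫ f) := by
  rw [← lift_whiskerLeft, lift_fst_snd, Category.id_comp]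

theorem associator_eq_lift (X Y Z : C) : (α_ X Y Z).hom =
    lift (fst (X ⊗ Y) Z ≫ fst X Y) (lift (fst (X ⊗ Y) Z ≫ snd X Y) (snd (X ⊗ Y) Z)) := by
  rw [← lift_associator, ← comp_lift, lift_fst_snd, Category.comp_id, lift_fst_snd,
    Category.id_comp]

theorem braiding_eq_lift (X Y : C) : (β_ X Y).hom = lift (snd X Y) (fst X Y) := by
  rw [← lift_braiding, lift_fst_snd, Category.id_comp]

theorem comp_associator {f : W ⟶ (X ⊗ Y) ⊗ Z} (_ : Deterministic f) : f ≫ (α_ X Y Z).hom =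
    lift ((f ≫ fst (X ⊗ Y) Z) ≫ fst X Y)
      (lift ((f ≫ fst (X ⊗ Y) Z) ≫ snd X Y) (f ≫ snd (X ⊗ Y) Z)) := by
  rw [associator_eq_lift, comp_lift, comp_lift, Category.assoc, Category.assoc]

theorem comp_braiding {f : W ⟶ X ⊗ Y} (_ : Deterministic f) :
    f ≫ (β_ X Y).hom = lift (f ≫ snd X Y) (f ≫ fst X Y) := by
  rw [braiding_eq_lift, comp_lift]

theorem lift_discard_eq (f : X ⟶ Y) : lift ε[X] f = f ≫ (λ_ Y).inv := by
  simp [lift]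

theorem leftUnitor_eq_snd (X : C) : (λ_ X).hom = snd (𝟙_ C) X := by
  simp [snd, CopyDiscardCategory.discard_unit]

theorem rightUnitor_eq_fst (X : C) : (ρ_ X).hom = fst X (𝟙_ C) := by
  simp [fst, CopyDiscardCategory.discard_unit]

/-- All four components read copies of the same input, and copying twice is invariant under the
middle-four shuffle because `Δ` is itself a comonoid homomorphism. -/
theorem lift_lift_tensorδ {X' Y' : C} (a : W ⟶ X) (b : W ⟶ X') (c : W ⟶ Y) (d : W ⟶ Y') :
    lift (lift a b) (lift c d) ≫ tensorδ X Y X' Y' = lift (lift a c) (lift b d) := by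
  have h : ∀ {X Y X' Y' : C} (a : W ⟶ X) (b : W ⟶ Y) (c : W ⟶ X') (d : W ⟶ Y'),
      lift (lift a b) (lift c d) = Δ[W] ≫ (Δ[W] ⊗ₘ Δ[W]) ≫ ((a ⊗ₘ b) ⊗ₘ (c ⊗ₘ d)) := by
    intros
    rw [lift, lift, lift, tensorHom_comp_tensorHom]
  have h' : Δ[W] ≫ (Δ[W] ⊗ₘ Δ[W]) ≫ tensorμ W W W W = Δ[W] ≫ (Δ[W] ⊗ₘ Δ[W]) := by
    rw [← CopyDiscardCategory.copy_tensor, Deterministic.copy_natural]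
  have h'' : lift (lift a c) (lift b d) ≫ tensorμ X Y X' Y' = lift (lift a b) (lift c d) := by
    rw [h, h, Category.assoc, Category.assoc, tensorμ_natural, reassoc_of% h']
  rw [← h'', Category.assoc, tensorμ_tensorδ, Category.comp_id]

/-- With `deterministic_unit_ext`: on deterministic morphisms the tensor product is a cartesian
product and the unit is terminal. -/
theorem ext_fst_snd {f g : X ⟶ Y ⊗ Z} (hf : Deterministic f) (hg : Deterministic g)
    (h : f ≫ fst Y Z = g ≫ fst Y Z) (h' : f ≫ snd Y Z = g ≫ snd Y Z) : f = g := by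
  rw [← Category.comp_id f, ← Category.comp_id g, ← lift_fst_snd, comp_lift, comp_lift, h, h']

theorem deterministic_unit_ext {f g : X ⟶ 𝟙_ C} (hf : Deterministic f) (hg : Deterministic g) :
    f = g := by
  have := (Deterministic.discard_natural f).trans (Deterministic.discard_natural g).symm
  rwa [CopyDiscardCategory.discard_unit, Category.comp_id, Category.comp_id] at this

/-! ### The action of predicates -/

/-- The restriction of a morphism along a predicate on its domain. -/
def act (e : X ⟶ 𝟙_ C) (f : X ⟶ Y) : X ⟶ Y := lift e f ≫ (λ_ Y).hom

theorem act_comp (e : X ⟶ 𝟙_ C) (f : X ⟶ Y) (g : Y ⟶ Z) : act e f ≫ g = act e (f ≫ g) := by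
  rw [act, Category.assoc, ← leftUnitor_naturality, lift_whiskerLeft_assoc, act]

theorem comp_act (f : X ⟶ Y) [Deterministic f] (e : Y ⟶ 𝟙_ C) (g : Y ⟶ Z) :
    f ≫ act e g = act (f ≫ e) (f ≫ g) := by
  rw [act, comp_lift_assoc, act]

theorem lift_rightUnitor (e : X ⟶ 𝟙_ C) (f : X ⟶ Y) : lift f e ≫ (ρ_ Y).hom = act e f := by
  rw [act, ← lift_braiding, Category.assoc, braiding_rightUnitor]

/-- A predicate on the shared input can be moved between the components of a pairing and the whole,
by coassociativity; `lift_act_right` adds cocommutativity. -/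
theorem lift_act_left (e : X ⟶ 𝟙_ C) (f : X ⟶ Y) (g : X ⟶ Z) :
    lift (act e f) g = act e (lift f g) := by
  rw [act, act, ← lift_associator, ← lift_whiskerRight, leftUnitor_whiskerRight, Category.assoc]

theorem lift_act_right (e : X ⟶ 𝟙_ C) (f : X ⟶ Y) (g : X ⟶ Z) :
    lift f (act e g) = act e (lift f g) := by
  rw [← lift_act_left, act, ← lift_rightUnitor e f, ← lift_whiskerLeft, ← lift_whiskerRight,
    ← lift_associator, Category.assoc, triangle]

theorem act_comm (e d : X ⟶ 𝟙_ C) : act e d = act d e := by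
  rw [← lift_rightUnitor, ← unitors_equal, act]

theorem act_mono {e e' : X ⟶ 𝟙_ C} {f f' : X ⟶ Y} (h : e ≤ e') (h' : f ≤ f') :
    act e f ≤ act e' f' :=
  comp_mono (lift_mono h h') le_rfl

@[simp]
theorem discard_act (f : X ⟶ Y) : act ε[X] f = f := lift_discard_left f

@[simp]
theorem act_discard (e : X ⟶ 𝟙_ C) : act e ε[X] = e := by
  rw [← lift_rightUnitor, ← unitors_equal, lift_discard_left]

theorem le_discard (e : X ⟶ 𝟙_ C) : e ≤ ε[X] := by
  have := lax_discard e
  rwa [CopyDiscardCategory.discard_unit, Category.comp_id] at this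

theorem act_le (e : X ⟶ 𝟙_ C) (f : X ⟶ Y) : act e f ≤ f :=
  (act_mono (le_discard e) le_rfl).trans_eq (discard_act f)

theorem act_le_left (e d : X ⟶ 𝟙_ C) : act e d ≤ e :=
  (act_mono le_rfl (le_discard d)).trans_eq (act_discard e)

/-- Lax naturality of copying, with `Δ` of the unit a coherence isomorphism, makes a predicate at
most its own square. With `act_le` and `act_le_left`, `act e d` is therefore the meet of `e` and
`d`. -/
theorem le_act {e d k : X ⟶ 𝟙_ C} (h : k ≤ e) (h' : k ≤ d) : k ≤ act e d := by
  refine le_trans ?_ (act_mono h h')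
  have := comp_mono (lax_copy k) (le_refl (λ_ (𝟙_ C)).hom)
  rwa [CopyDiscardCategory.copy_unit, Category.assoc, Iso.inv_hom_id, Category.comp_id] at this

end

/-! ### The right adjoints of the diagonals -/

section

variable {X Y Z W : C}

theorem merge_unit : merge (𝟙_ C) = (λ_ (𝟙_ C)).hom := by
  refine right_adjoint_unique (copy_adj_unit _) (copy_adj_counit _) ?_ ?_ <;>
    simp [CopyDiscardCategory.copy_unit]

/-- By cocommutativity both sides are right adjoint to `Δ`. -/
theorem braiding_merge (X : C) : (β_ X X).hom ≫ merge X = merge X := by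
  refine right_adjoint_unique (f := Δ[X]) ?_ ?_ (copy_adj_unit _) (copy_adj_counit _)
  · rw [IsCommComonObj.comul_comm_assoc]
    exact copy_adj_unit X
  · have := comp_mono (comp_mono (le_refl (β_ X X).hom) (copy_adj_counit X)) (le_refl (β_ X X).hom)
    rw [Category.assoc, Category.assoc, IsCommComonObj.comul_comm, Category.comp_id,
      SymmetricCategory.symmetry] at this
    rwa [Category.assoc]

theorem lift_merge_comm (f g : X ⟶ Y) : lift f g ≫ merge Y = lift g f ≫ merge Y := by
  rw [← lift_braiding g f, Category.assoc, braiding_merge]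

theorem lift_cap_comm (f g : X ⟶ Y) : lift f g ≫ cap Y = lift g f ≫ cap Y := by
  rw [cap, ← Category.assoc, lift_merge_comm, Category.assoc]

/-- The right adjoint of the first projection. -/
def coproj (X Y : C) : X ⟶ X ⊗ Y := (ρ_ X).inv ≫ X ◁ create Y

/-- Precomposition with `coproj` is thus left adjoint to precomposition with `fst`: existential
quantification is left adjoint to weakening. -/
theorem fst_adj (X Y : C) : 𝟙 (X ⊗ Y) ≤ fst X Y ≫ coproj X Y ∧ coproj X Y ≫ fst X Y ≤ 𝟙 X := by
  refine adj_comp ?_ ?_ (by simp) (by simp)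
  · have := whiskerLeft_mono X (discard_adj_unit Y)
    simpa using this
  · have := whiskerLeft_mono X (discard_adj_counit Y)
    simpa using this

theorem le_fst_coproj (f : X ⊗ Y ⟶ Z) : f ≤ fst X Y ≫ coproj X Y ≫ f := by
  have := comp_mono (fst_adj X Y).1 (le_refl f)
  rwa [Category.id_comp, Category.assoc] at this

theorem coproj_fst_le (f : X ⟶ Z) : coproj X Y ≫ fst X Y ≫ f ≤ f := by
  have := comp_mono (fst_adj X Y).2 (le_refl f)
  rwa [Category.id_comp, Category.assoc] at this

/-- `Δ ≫ fst` is the identity, hence so is the composite of the right adjoints. -/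
theorem coproj_merge (X : C) : coproj X X ≫ merge X = 𝟙 X := by
  have h₁ := fst_adj X X
  have h₂ := adj_comp (copy_adj_unit X) (copy_adj_counit X) h₁.1 h₁.2
  have h₃ : Δ[X] ≫ fst X X = 𝟙 X := by
    rw [← lift_id_id, lift_fst]
  rw [h₃] at h₂
  exact right_adjoint_unique (f := 𝟙 X) h₂.1 h₂.2 (by simp) (by simp)

/-- A component that does not depend on the new wire can be pulled out of the quantifier: by
interchange, `Y` may be created after `X` has been copied. -/
theorem coproj_lift_fst_left (c : X ⟶ Z) (x : X ⊗ Y ⟶ W) :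
    coproj X Y ≫ lift (fst X Y ≫ c) x = lift c (coproj X Y ≫ x) := by
  have h : Δ[X] ▷ Y ≫ (α_ X X Y).hom = lift (fst X Y) (𝟙 _) := by
    rw [whiskerRight_eq_lift, comp_copy, lift_associator, lift_fst_snd]
  have h' : coproj X Y ≫ lift (fst X Y) (𝟙 _) = Δ[X] ≫ X ◁ coproj X Y := by
    rw [← h, coproj]
    simp [whisker_exchange_assoc]
  have h'' : lift (fst X Y ≫ c) x = lift (fst X Y) (𝟙 _) ≫ (c ⊗ₘ x) := by simp
  rw [h'', reassoc_of% h', lift, ← id_tensorHom, tensorHom_comp_tensorHom, Category.id_comp]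

theorem coproj_lift_fst_left_assoc (c : X ⟶ Z) (x : X ⊗ Y ⟶ W) {V : C} (k : Z ⊗ W ⟶ V) :
    coproj X Y ≫ lift (fst X Y ≫ c) x ≫ k = lift c (coproj X Y ≫ x) ≫ k := by
  rw [← coproj_lift_fst_left, Category.assoc]

theorem coproj_lift_fst_right (x : X ⊗ Y ⟶ W) (c : X ⟶ Z) :
    coproj X Y ≫ lift x (fst X Y ≫ c) = lift (coproj X Y ≫ x) c := by
  rw [← lift_braiding, coproj_lift_fst_left_assoc, lift_braiding]

theorem coproj_lift_fst_right_assoc (x : X ⊗ Y ⟶ W) (c : X ⟶ Z) {V : C} (k : W ⊗ Z ⟶ V) :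
    coproj X Y ≫ lift x (fst X Y ≫ c) ≫ k = lift (coproj X Y ≫ x) c ≫ k := by
  rw [← coproj_lift_fst_right, Category.assoc]

theorem coproj_snd (X Y : C) : coproj X Y ≫ snd X Y = ε[X] ≫ create Y := by
  rw [coproj, snd, Category.assoc, whisker_exchange_assoc]
  simp [unitors_equal]

/-- A freshly created wire is neutral for merging. In logical terms: to choose `y` with `y = a x`
and return it is `a`. -/
theorem coproj_lift_fst_snd_merge (a : X ⟶ Y) :
    coproj X Y ≫ lift (fst X Y ≫ a) (snd X Y) ≫ merge Y = a := by
  have h : lift a (ε[X] ≫ create Y) = a ≫ coproj Y Y := by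
    rw [← lift_whiskerLeft, coproj, ← Category.assoc a]
    congr 1
    rw [← cancel_mono (ρ_ Y).hom]
    simp
  rw [coproj_lift_fst_left_assoc, coproj_snd, h, Category.assoc, coproj_merge, Category.comp_id]

theorem coproj_lift_cap (a : X ⟶ Y) [Deterministic a] :
    coproj X Y ≫ lift (fst X Y ≫ a) (snd X Y) ≫ cap Y = ε[X] := by
  have := congr($(coproj_lift_fst_snd_merge a) ≫ ε[Y])
  simpa only [cap, Category.assoc, Deterministic.discard_natural a] using this

/-- The Frobenius equation with the first output deleted. It expresses `merge` through `cap`, which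
is how equality gets its substitution property. -/
theorem merge_frobenius (X : C) :
    X ◁ Δ[X] ≫ (α_ X X X).inv ≫ cap X ▷ X ≫ (λ_ X).hom = merge X := by
  have := congr($(frobenius_left X) ≫ ε[X] ▷ X ≫ (λ_ X).hom)
  simpa [cap] using this

/-- Restriction along an equality. -/
theorem act_lift_cap_right (u w : X ⟶ Y) [Deterministic w] :
    act (lift u w ≫ cap Y) w = lift u w ≫ merge Y := by
  -- Merging copies `w`, compares `u` with one copy and returns the other; `w` must be deterministic
  -- to be copied.
  rw [← merge_frobenius, lift_whiskerLeft_assoc, comp_copy, lift_associator_inv_assoc,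
    lift_whiskerRight_assoc, act]

theorem act_lift_cap_left (u w : X ⟶ Y) [Deterministic u] :
    act (lift u w ≫ cap Y) u = lift u w ≫ merge Y := by
  rw [lift_cap_comm, act_lift_cap_right, lift_merge_comm]

/-- The semantic Leibniz rule: both sides are the merge of `u` and `w`. -/
theorem act_lift_cap_eq (u w : X ⟶ Y) [Deterministic u] [Deterministic w] :
    act (lift u w ≫ cap Y) u = act (lift u w ≫ cap Y) w := by
  rw [act_lift_cap_left, act_lift_cap_right]

/-- Reflexivity of equality is the unit of the adjunction between `Δ` and `merge`, together with
totality of `u`. -/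
theorem discard_le_lift_cap (u : X ⟶ Y) [Deterministic u] : ε[X] ≤ lift u u ≫ cap Y := by
  rw [← comp_copy, cap, Category.assoc, ← Deterministic.discard_natural u]
  have := comp_mono (le_refl u) (comp_mono (copy_adj_unit Y) (le_refl ε[Y]))
  simpa using this

/-- Start from `u = u`, restrict it along `e`, and replace the second `u` by `w`. -/
theorem le_lift_cap_of_act_eq {e : X ⟶ 𝟙_ C} {u w : X ⟶ Y} [Deterministic u]
    (h : act e u = act e w) : e ≤ lift u w ≫ cap Y := by
  calc e = act e ε[X] := (act_discard e).symm
    _ ≤ act e (lift u u ≫ cap Y) := act_mono le_rfl (discard_le_lift_cap u)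
    _ = act e (lift u w ≫ cap Y) := by
      rw [← act_comp, ← lift_act_right, h, lift_act_right, act_comp]
    _ ≤ lift u w ≫ cap Y := act_le _ _

/-- Frobenius reciprocity for the quantifier, as an equality. -/
theorem coproj_act_fst (φ : X ⟶ 𝟙_ C) (ψ : X ⊗ Y ⟶ W) :
    coproj X Y ≫ act (fst X Y ≫ φ) ψ = act φ (coproj X Y ≫ ψ) := by
  rw [act, coproj_lift_fst_left_assoc, act]

theorem comp_lift_comp_cap {U : C} (f : U ⟶ W) [Deterministic f] (g : W ⟶ X) (R : X ⟶ Y)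
    (h : W ⟶ Y) :
    f ≫ lift (g ≫ R) h ≫ cap Y = lift ((f ≫ g) ≫ R) (f ≫ h) ≫ cap Y := by
  rw [comp_lift_assoc, Category.assoc]

/-! ### Bending wires -/

/-- The cup creates a wire and copies it: one copy is tested by `R`, the other is returned. -/
theorem bend_eq (R : X ⊗ Y ⟶ 𝟙_ C) : bend R = coproj X Y ≫ act R (snd X Y) := by
  have h : X ◁ Δ[Y] ≫ (α_ X Y Y).inv = lift (𝟙 _) (snd X Y) := by
    rw [whiskerLeft_eq_lift, comp_copy, lift_associator_inv, lift_fst_snd]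
  rw [bend, cup, MonoidalCategory.whiskerLeft_comp, Category.assoc, reassoc_of% h, coproj,
    lift_whiskerRight_assoc, act]
  simp

theorem bend_discard (R : X ⊗ Y ⟶ 𝟙_ C) : bend R ≫ ε[Y] = coproj X Y ≫ R := by
  rw [bend_eq, Category.assoc, act_comp, Deterministic.discard_natural, act_discard]

/-- Bending the output wire to an input wire. -/
def unbend (R : X ⟶ Y) : X ⊗ Y ⟶ 𝟙_ C := lift (fst X Y ≫ R) (snd X Y) ≫ cap Y

/-- With `unbend_bend`, the snake equations in terms of pairings. -/
theorem bend_unbend (R : X ⟶ Y) : bend (unbend R) = R := by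
  rw [bend_eq, unbend, act_lift_cap_right, coproj_lift_fst_snd_merge]

/-- The Beck-Chevalley condition: the new wire is created beside `a`, so interchange applies. -/
theorem coproj_whiskerRight (a : X ⟶ Z) [Deterministic a] :
    a ≫ coproj Z Y = coproj X Y ≫ a ▷ Y := by
  rw [coproj, coproj, Category.assoc, whisker_exchange]
  simp

theorem unbend_bend (R : X ⊗ Y ⟶ 𝟙_ C) : unbend (bend R) = R := by
  -- In the context `(x, y), y'`: the bent `R` chooses a fresh `y'`, tests `R(x, y')` and returns
  -- `y'`.
  have h₁ : fst X Y ≫ bend R = coproj (X ⊗ Y) Y ≫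
      act ((fst X Y) ▷ Y ≫ R) (snd (X ⊗ Y) Y) := by
    have : fst X Y ▷ Y ≫ snd X Y = snd (X ⊗ Y) Y := by
      rw [whiskerRight_eq_lift, lift_snd]
    rw [bend_eq, ← Category.assoc, coproj_whiskerRight, Category.assoc, comp_act, this]
  set e := lift (snd (X ⊗ Y) Y) (fst (X ⊗ Y) Y ≫ snd X Y) ≫ cap Y with he
  -- Here `e` says `y' = y`, and under it `(x, y')` may be replaced by `(x, y)`. Then `R(x, y)`
  -- leaves the quantifier, and `∃ y', y' = y` is true.
  have h₂ : act e (fst X Y ▷ Y) = act e (fst (X ⊗ Y) Y) := by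
    rw [whiskerRight_eq_lift, ← lift_act_right, he, act_lift_cap_eq, lift_act_right, ← comp_lift,
      lift_fst_snd, Category.comp_id]
  rw [unbend, h₁, ← coproj_lift_fst_right_assoc, lift_act_left, act_comp, ← he, act_comm,
    ← act_comp, h₂, act_comp, act_comm, coproj_act_fst, he, lift_cap_comm, coproj_lift_cap,
    act_discard]

/-- The isomorphism `e` is there for the left unitor: a context with one variable of type `A` is
interpreted as `I ⊗ A`, not as `A`. -/
theorem eq_lift_bend (e : X ≅ Z) (R : X ⊗ Y ⟶ 𝟙_ C) :
    R = lift ((fst X Y ≫ e.hom) ≫ e.inv ≫ bend R) (snd X Y) ≫ cap Y := by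
  rw [Category.assoc, Iso.hom_inv_id_assoc, ← unbend, unbend_bend]

theorem bend_eq_of (e : X ≅ Z) {R : X ⊗ Y ⟶ 𝟙_ C} {R' : Z ⟶ Y}
    (h : R = lift ((fst X Y ≫ e.hom) ≫ R') (snd X Y) ≫ cap Y) : e.inv ≫ bend R = R' := by
  rw [h, Category.assoc, ← unbend, bend_unbend, Iso.inv_hom_id_assoc]

theorem bend_mono {R R' : X ⊗ Y ⟶ 𝟙_ C} (h : R ≤ R') : bend R ≤ bend R' := by
  rw [bend_eq, bend_eq]
  exact comp_mono le_rfl (act_mono h le_rfl)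

/-- The defining property of a composite relation. -/
theorem coproj_act_lift_cap {U : C} (a : U ⟶ X) (R : X ⟶ Y) (S : Y ⟶ Z) (c : U ⟶ Z) :
    coproj U Y ≫ act (lift (fst U Y ≫ a ≫ R) (snd U Y) ≫ cap Y)
      (lift (snd U Y ≫ S) (fst U Y ≫ c) ≫ cap Z) = lift (a ≫ R ≫ S) c ≫ cap Z := by
  -- The first predicate is moved onto the middle variable, where it becomes a merge with `a ≫ R`;
  -- the quantified wire is then absorbed.
  have := coproj_lift_fst_snd_merge (a ≫ R)
  rw [← act_comp, ← lift_act_left, ← act_comp, act_lift_cap_right, coproj_lift_fst_right_assoc,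
    ← Category.assoc a, ← Category.assoc (coproj _ _),
    this]

/-- The shuffled pair of merges is also right adjoint to the copy of `X ⊗ Y`. -/
theorem merge_tensor (X Y : C) :
    merge (X ⊗ Y) = tensorδ X X Y Y ≫ (merge X ⊗ₘ merge Y) := by
  refine right_adjoint_unique (copy_adj_unit _) (copy_adj_counit _) ?_ ?_ <;>
    rw [CopyDiscardCategory.copy_tensor]
  · have := tensor_mono (copy_adj_unit X) (copy_adj_unit Y)
    rw [id_tensorHom_id] at this
    rw [Category.assoc, tensorμ_tensorδ_assoc, tensorHom_comp_tensorHom]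
    exact this
  · have := comp_mono (le_refl (tensorδ X X Y Y)) (comp_mono
      (tensor_mono (copy_adj_counit X) (copy_adj_counit Y)) (le_refl (tensorμ X X Y Y)))
    rw [id_tensorHom_id, Category.id_comp, tensorδ_tensorμ, ← tensorHom_comp_tensorHom,
      Category.assoc] at this
    rw [Category.assoc]
    exact this

theorem cap_tensor (X Y : C) :
    cap (X ⊗ Y) = tensorδ X X Y Y ≫ (cap X ⊗ₘ cap Y) ≫ (λ_ (𝟙_ C)).hom := by
  rw [cap, cap, cap, merge_tensor, CopyDiscardCategory.discard_tensor, Category.assoc,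
    tensorHom_comp_tensorHom_assoc]

/-- Equality of pairs is the conjunction of the equalities of their components. -/
theorem lift_lift_cap (a a' : W ⟶ X) (b b' : W ⟶ Y) :
    lift (lift a b) (lift a' b') ≫ cap (X ⊗ Y) =
      act (lift a a' ≫ cap X) (lift b b' ≫ cap Y) := by
  rw [cap_tensor, reassoc_of% lift_lift_tensorδ, lift_tensorHom_assoc, act]

theorem act_lift_cap_tensor {X' Y' : C} {x : W ⟶ X ⊗ X'} {y : W ⟶ Y ⊗ Y'} (_ : Deterministic x)
    (_ : Deterministic y) (R : X ⟶ Y) (R' : X' ⟶ Y') :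
    act (lift ((x ≫ fst X X') ≫ R) (y ≫ fst Y Y') ≫ cap Y)
        (lift ((x ≫ snd X X') ≫ R') (y ≫ snd Y Y') ≫ cap Y') =
      lift (x ≫ (R ⊗ₘ R')) y ≫ cap (Y ⊗ Y') := by
  rw [← lift_lift_cap, ← comp_lift y, lift_fst_snd, Category.comp_id, ← lift_tensorHom,
    ← comp_lift x, lift_fst_snd, Category.comp_id]

end

end BicategoryOfRelations

namespace RegularLogic

open ComonObj BicategoryOfRelations

namespace Interpretation

variable {S : Signature.{u, v}} {B : Type u₁} [Category.{v₁} B] [MonoidalCategory.{v₁} B]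
  [BicategoryOfRelations B] (M : Interpretation S B)

/-! ### Interpretation of terms and formulas by pairings -/

theorem var_succ {Γ : Ctx S} {A A' : S.Typ} (x : Var Γ A) :
    M.var (.succ x : Var (A' :: Γ) A) = fst (M.ctx Γ) (M.typ A') ≫ M.var x := by
  rw [fst, Category.assoc]
  rfl

theorem term_app {Γ : Ctx S} {A A' : S.Typ} (f : S.Fun A A') (t : Term S Γ A) :
    M.term (.app f t) = M.term t ≫ M.fn f := rfl

theorem term_pair {Γ : Ctx S} {A A' : S.Typ} (t : Term S Γ A) (s : Term S Γ A') :
    M.term (.pair t s) = lift (M.term t) (M.term s) := rfl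

theorem term_fst {Γ : Ctx S} {A A' : S.Typ} (t : Term S Γ (.prod A A')) :
    M.term (.fst t) = M.term t ≫ fst (M.typ A) (M.typ A') := rfl

theorem term_snd {Γ : Ctx S} {A A' : S.Typ} (t : Term S Γ (.prod A A')) :
    M.term (.snd t) = M.term t ≫ snd (M.typ A) (M.typ A') := rfl

theorem formula_rel {Γ : Ctx S} {A A' : S.Typ} (R : S.Rel A A') (t : Term S Γ A)
    (s : Term S Γ A') :
    M.formula (.rel R t s) = lift (M.term t ≫ M.rel R) (M.term s) ≫ cap (M.typ A') :=
  (Category.assoc _ _ _).symm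

theorem formula_eq {Γ : Ctx S} {A : S.Typ} (t s : Term S Γ A) :
    M.formula (.eq t s) = lift (M.term t) (M.term s) ≫ cap (M.typ A) :=
  (Category.assoc _ _ _).symm

theorem formula_top {Γ : Ctx S} : M.formula (.top : Formula S Γ) = ε[M.ctx Γ] := rfl

theorem formula_and {Γ : Ctx S} (φ ψ : Formula S Γ) :
    M.formula (.and φ ψ) = act (M.formula φ) (M.formula ψ) := by
  rw [act, ← merge_unit]
  exact (Category.assoc _ _ _).symm

/-- The moved variable is deleted at once, so quantifying reduces to precomposition with `coproj`.
-/
theorem formula_ex {Γ : Ctx S} {A : S.Typ} (φ : Formula S (A :: Γ)) :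
    M.formula (.ex φ) = coproj (M.ctx Γ) (M.typ A) ≫ M.formula φ :=
   bend_discard (X := M.ctx Γ) (Y := M.typ A) (M.formula φ)

instance deterministic_var {Γ : Ctx S} {A : S.Typ} (x : Var Γ A) : Deterministic (M.var x) := by
  induction x with
  | zero => exact inferInstanceAs (Deterministic (snd (M.ctx _) (M.typ _)))
  | succ x ih =>
    rw [var_succ]
    exact deterministic_comp (inferInstanceAs (Deterministic (fst (M.ctx _) (M.typ _)))) ih

/-- This is where function symbols have to be maps. Determinism lets terms be substituted into
formulas, which copy and delete their variables. -/
instance deterministic_term {Γ : Ctx S} {A : S.Typ} (t : Term S Γ A) :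
    Deterministic (M.term t) := by
  induction t with
  | var x => exact M.deterministic_var x
  | app f t ih => exact deterministic_comp ih (M.isMap_fn f).deterministic
  | pair t s ih ih' => exact inferInstanceAs (Deterministic (lift (M.term t) (M.term s)))
  | fst t ih =>
    exact deterministic_comp ih (inferInstanceAs (Deterministic (fst (M.typ _) (M.typ _))))
  | snd t ih =>
    exact deterministic_comp ih (inferInstanceAs (Deterministic (snd (M.typ _) (M.typ _))))
  | star => exact inferInstanceAs (Deterministic ε[M.ctx Γ])

/-! ### Interpretation of substitutions -/

/-- The interpretation of a tuple of terms. -/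
def subst {Γ : Ctx S} : {Γ₂ : Ctx S} → Subst S Γ Γ₂ → (M.ctx Γ ⟶ M.ctx Γ₂)
  | [], _ => ε[M.ctx Γ]
  | _ :: _, σ => lift (subst fun _ x => σ _ x.succ) (M.term (σ _ .zero))

theorem subst_cons {Γ Γ₂ : Ctx S} {A : S.Typ} (σ : Subst S Γ Γ₂) (t : Term S Γ A) :
    M.subst (σ.cons t) = lift (M.subst σ) (M.term t) := rfl

instance deterministic_subst {Γ : Ctx S} : {Γ₂ : Ctx S} → (σ : Subst S Γ Γ₂) →
    Deterministic (M.subst σ)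
  | [], _ => inferInstanceAs (Deterministic ε[M.ctx Γ])
  | _ :: _, σ =>
    have := deterministic_subst (fun _ x => σ _ x.succ : Subst S Γ _)
    inferInstanceAs (Deterministic (lift (M.subst (fun _ x => σ _ x.succ : Subst S Γ _))
      (M.term (σ _ .zero))))

theorem subst_comp_var {Γ Γ₂ : Ctx S} {A : S.Typ} (σ : Subst S Γ Γ₂) (x : Var Γ₂ A) :
    M.subst σ ≫ M.var x = M.term (σ A x) := by
  induction x with
  | zero =>
    have := M.deterministic_subst (fun _ x => σ _ x.succ : Subst S Γ _)
    exact lift_snd (M.subst (fun _ x => σ _ x.succ : Subst S Γ _)) (M.term (σ _ .zero))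
  | succ x ih =>
    rw [var_succ]
    exact (lift_fst_assoc (M.subst (fun _ x => σ _ x.succ : Subst S Γ _)) (M.term (σ _ .zero))
      (M.var x)).trans (ih _)

theorem term_subst {Γ Γ₂ : Ctx S} {A : S.Typ} (σ : Subst S Γ Γ₂) (t : Term S Γ₂ A) :
    M.term (t.subst σ) = M.subst σ ≫ M.term t := by
  induction t with
  | var x => exact (M.subst_comp_var σ x).symm
  | app f t ih =>
    rw [Term.subst, term_app, term_app, ih]
    exact Category.assoc _ _ _
  | pair t s ih ih' =>
    rw [Term.subst, term_pair, term_pair, ih, ih']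
    exact (comp_lift _ _ _).symm
  | fst t ih =>
    rw [Term.subst, term_fst, term_fst, ih]
    exact Category.assoc _ _ _
  | snd t ih =>
    rw [Term.subst, term_snd, term_snd, ih]
    exact Category.assoc _ _ _
  | star => exact (Deterministic.discard_natural (M.subst σ)).symm

/-- A context is a cartesian product with respect to deterministic morphisms. Identities between
interpreted substitutions can therefore be checked on variables, as in `subst_eq`. -/
theorem ctx_ext {X : B} {Γ : Ctx S} {f g : X ⟶ M.ctx Γ} (hf : Deterministic f)
    (hg : Deterministic g) (h : ∀ (A : S.Typ) (x : Var Γ A), f ≫ M.var x = g ≫ M.var x) :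
    f = g := by
  induction Γ with
  | nil =>
    exact deterministic_unit_ext (f := f) (g := g) hf hg
  | cons A Γ ih =>
    have hp : Deterministic (fst (M.ctx Γ) (M.typ A)) := inferInstance
    refine ext_fst_snd (Y := M.ctx Γ) (Z := M.typ A) hf hg (ih (deterministic_comp hf hp)
      (deterministic_comp hg hp) fun A' x => ?_) (h A .zero)
    have := h A' x.succ
    rw [var_succ] at this
    exact (Category.assoc _ _ _).trans (this.trans (Category.assoc _ _ _).symm)

theorem subst_eq {Γ Γ₂ : Ctx S} {σ : Subst S Γ Γ₂} {f : M.ctx Γ ⟶ M.ctx Γ₂}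
    (hf : Deterministic f) (h : ∀ (A : S.Typ) (x : Var Γ₂ A), M.term (σ A x) = f ≫ M.var x) :
    M.subst σ = f :=
  M.ctx_ext inferInstance hf fun A x => (M.subst_comp_var σ x).trans (h A x)

theorem subst_comp {Γ Γ₂ Γ₃ : Ctx S} (σ : Subst S Γ₂ Γ₃) (τ : Subst S Γ Γ₂) :
    M.subst (σ.comp τ) = M.subst τ ≫ M.subst σ :=
  M.subst_eq inferInstance fun A x => by
    rw [Category.assoc, subst_comp_var, Subst.comp, term_subst]

theorem subst_id (Γ : Ctx S) : M.subst (Subst.id Γ) = 𝟙 (M.ctx Γ) :=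
  M.subst_eq inferInstance fun _ _ => (Category.id_comp _).symm

theorem subst_wk (Γ : Ctx S) (A : S.Typ) :
    M.subst (Subst.wk Γ A) = fst (M.ctx Γ) (M.typ A) :=
  M.subst_eq (inferInstanceAs (Deterministic (fst (M.ctx Γ) (M.typ A)))) fun _ x => M.var_succ x

theorem subst_lift {Γ Γ₂ : Ctx S} (σ : Subst S Γ Γ₂) (A : S.Typ) :
    M.subst (σ.lift A) = M.subst σ ▷ M.typ A := by
  rw [Subst.lift, subst_cons, subst_comp, subst_wk]
  exact (whiskerRight_eq_lift _).symm

theorem term_wk {Γ : Ctx S} {A A' : S.Typ} (t : Term S Γ A) :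
    M.term (t.wk A') = fst (M.ctx Γ) (M.typ A') ≫ M.term t := by
  rw [Term.wk, term_subst, subst_wk]
  rfl

theorem term_inst {Γ : Ctx S} {A A' : S.Typ} (r : Term S (A :: Γ) A') (t : Term S Γ A) :
    M.term (r.inst t) = lift (𝟙 (M.ctx Γ)) (M.term t) ≫ M.term r := by
  rw [Term.inst, term_subst, subst_cons, subst_id]
  rfl

theorem formula_subst {Γ Γ₂ : Ctx S} (σ : Subst S Γ Γ₂) (φ : Formula S Γ₂) :
    M.formula (φ.subst σ) = M.subst σ ≫ M.formula φ := by
  induction φ generalizing Γ with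
  | rel R t s =>
    rw [Formula.subst, formula_rel, formula_rel, term_subst, term_subst]
    exact (comp_lift_comp_cap (M.subst σ) (M.term t) (M.rel R) (M.term s)).symm
  | eq t s =>
    rw [Formula.subst, formula_eq, formula_eq, term_subst, term_subst, comp_lift_assoc]
  | top => exact (Deterministic.discard_natural (M.subst σ)).symm
  | and φ ψ ih ih' =>
    rw [Formula.subst, formula_and, formula_and, ih, ih', comp_act]
  | @ex Γ₂ A φ ih =>
    rw [Formula.subst, formula_ex, formula_ex, ih, subst_lift]
    refine (Category.assoc _ _ _).symm.trans (Eq.trans ?_ (Category.assoc _ _ _))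
    -- Beck-Chevalley: the lifted substitution is `M.subst σ` beside an untouched wire.
    exact congr($((coproj_whiskerRight (Y := M.typ A) (M.subst σ)).symm) ≫ M.formula φ)

theorem formula_wk {Γ : Ctx S} {A : S.Typ} (φ : Formula S Γ) :
    M.formula (φ.wk A) = fst (M.ctx Γ) (M.typ A) ≫ M.formula φ := by
  rw [Formula.wk, formula_subst, subst_wk]
  rfl

theorem formula_inst {Γ : Ctx S} {A : S.Typ} (φ : Formula S (A :: Γ)) (t : Term S Γ A) :
    M.formula (φ.inst t) = lift (𝟙 (M.ctx Γ)) (M.term t) ≫ M.formula φ := by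
  rw [Formula.inst, formula_subst, subst_cons, subst_id]
  rfl

/-! ### Soundness -/

/-- An interpretation is a model of a theory if the axioms of the theory hold in it. -/
def Models (T : Theory S) : Prop :=
  ∀ (Γ : Ctx S) (φ ψ : Formula S Γ), T.Axiom Γ φ ψ → M.formula φ ≤ M.formula ψ

theorem top_le_formula_eq {Γ : Ctx S} {A : S.Typ} {t s : Term S Γ A} (h : M.term t = M.term s) :
    M.formula .top ≤ M.formula (.eq t s) := by
  rw [formula_top, formula_eq, h]
  exact discard_le_lift_cap _

/-- `act_lift_cap_eq` under a pairing with the context. The codomain of `f` is arbitrary, so that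
formulas and terms are both covered. -/
theorem act_formula_eq {Γ : Ctx S} {A : S.Typ} {X : B} (t s : Term S Γ A)
    (f : M.ctx Γ ⊗ M.typ A ⟶ X) :
    act (M.formula (.eq t s)) (lift (𝟙 (M.ctx Γ)) (M.term t) ≫ f) =
      act (M.formula (.eq t s)) (lift (𝟙 (M.ctx Γ)) (M.term s) ≫ f) := by
  rw [formula_eq, ← act_comp, ← lift_act_right, act_lift_cap_eq, lift_act_right, act_comp]

variable {M} in
/-- The theorems of a theory hold in all its models. -/
theorem Models.sound {T : Theory S} (hM : M.Models T) {Γ : Ctx S} {φ ψ : Formula S Γ}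
    (h : T.Entails φ ψ) : M.formula φ ≤ M.formula ψ := by
  induction h with
  | ax h => exact hM _ _ _ h
  | identity φ => exact le_rfl
  | cut _ _ ih ih' => exact ih.trans ih'
  | substitution σ _ ih =>
    rw [formula_subst, formula_subst]
    exact comp_mono le_rfl ih
  | eq_refl t => exact M.top_le_formula_eq rfl
  | eq_formula φ t s =>
    rw [formula_and, formula_inst, formula_inst]
    exact (M.act_formula_eq t s (M.formula φ)).trans_le (act_le _ _)
  | eq_term r t s =>
    rw [formula_eq _ (r.inst t), term_inst, term_inst]
    have : Deterministic (lift (𝟙 _) (M.term t) ≫ M.term r) :=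
      deterministic_comp inferInstance (M.deterministic_term r)
    -- The two instances of `r` agree when restricted to `t = s`, and agreement along a predicate
    -- makes it imply their equality.
    exact le_lift_cap_of_act_eq (M.act_formula_eq t s (M.term r))
  | proj_fst t s => exact M.top_le_formula_eq (lift_fst (M.term t) (M.term s))
  | proj_snd t s => exact M.top_le_formula_eq (lift_snd (M.term t) (M.term s))
  | pair_eta t =>
    refine M.top_le_formula_eq ?_
    exact ext_fst_snd (M.deterministic_term _) (M.deterministic_term t)
      (lift_fst (M.term t.fst) (M.term t.snd)) (lift_snd (M.term t.fst) (M.term t.snd))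
  | singleton t =>
    refine M.top_le_formula_eq ?_
    exact deterministic_unit_ext (M.deterministic_term t) (M.deterministic_term _)
  | truth φ => exact le_discard _
  | and_intro _ _ ih ih' =>
    rw [formula_and]
    exact le_act ih ih'
  | and_left φ ψ =>
    rw [formula_and]
    exact act_le_left _ _
  | and_right φ ψ =>
    rw [formula_and]
    exact act_le _ _
  | @ex_down Γ A φ ψ _ ih =>
    rw [formula_wk] at ih
    rw [formula_ex]
    -- The two quantifier rules are the two transposes along the adjunction `fst_adj`.
    refine (comp_mono (le_refl (coproj (M.ctx Γ) (M.typ A))) ih).trans ?_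
    exact coproj_fst_le (M.formula ψ)
  | @ex_up Γ A φ ψ _ ih =>
    rw [formula_ex] at ih
    rw [formula_wk]
    refine le_trans ?_ (comp_mono (le_refl (fst (M.ctx Γ) (M.typ A))) ih)
    exact le_fst_coproj (X := M.ctx Γ) (Y := M.typ A) (M.formula φ)
  | @frobenius Γ A φ ψ =>
    rw [formula_and, formula_ex, formula_ex, formula_and, formula_wk]
    exact (coproj_act_fst (Y := M.typ A) (M.formula φ) (M.formula ψ)).ge

end Interpretation

end RegularLogic

/-! ### Coherence of strictly monoidal functors -/

namespace BicategoryOfRelations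

variable {B : Type u₁} [Category.{v₁} B] [MonoidalCategory.{v₁} B]

/-- In these three lemmas `f` stands for the image of a coherence isomorphism, and the identities
are kept as `Iso.refl` so that the statements match the monoidality axioms of the functor by
unfolding. -/
theorem refl_associativity {X Y Z : B} {f : (X ⊗ Y) ⊗ Z ⟶ X ⊗ (Y ⊗ Z)}
    (h : f = (α_ X Y Z).hom) : (Iso.refl (X ⊗ Y)).hom ▷ Z ≫ (Iso.refl ((X ⊗ Y) ⊗ Z)).hom ≫ f =
      (α_ X Y Z).hom ≫ X ◁ (Iso.refl (Y ⊗ Z)).hom ≫ (Iso.refl (X ⊗ (Y ⊗ Z))).hom := by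
  simp [h]

theorem refl_left_unitality {X : B} {f : 𝟙_ B ⊗ X ⟶ X} (h : f = (λ_ X).hom) :
    (λ_ X).hom = (Iso.refl (𝟙_ B)).hom ▷ X ≫ (Iso.refl (𝟙_ B ⊗ X)).hom ≫ f := by
  simp [h]

theorem refl_right_unitality {X : B} {f : X ⊗ 𝟙_ B ⟶ X} (h : f = (ρ_ X).hom) :
    (ρ_ X).hom = X ◁ (Iso.refl (𝟙_ B)).hom ≫ (Iso.refl (X ⊗ 𝟙_ B)).hom ≫ f := by
  simp [h]

end BicategoryOfRelations

namespace RegularLogic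

open ComonObj BicategoryOfRelations

namespace Interpretation

variable {S : Signature.{u, v}} {B : Type u₁} [Category.{v₁} B] [MonoidalCategory.{v₁} B]
  [BicategoryOfRelations B] (M : Interpretation S B)

/-! ### The functor out of the classifying category -/

/-- The morphism given by a formula in context `x : A, y : A'`. -/
def relation {A A' : S.Typ} (φ : Formula S [A', A]) : M.typ A ⟶ M.typ A' :=
  (λ_ (M.typ A)).inv ≫ bend (X := 𝟙_ B ⊗ M.typ A) (Y := M.typ A') (M.formula φ)

theorem term_vx {A A' : S.Typ} : M.term (Cl.vx : Term S [A', A] A) =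
    fst (𝟙_ B ⊗ M.typ A) (M.typ A') ≫ (λ_ (M.typ A)).hom := by
  rw [leftUnitor_eq_snd]
  exact M.var_succ _

/-- Unbending the bent formula: `φ(x, y)` says that `x`, sent through its relation, equals `y`. With
the converse `relation_eq_of`, a relation is computed by bringing the formula to this shape. -/
theorem formula_eq_relation {A A' : S.Typ} (φ : Formula S [A', A]) :
    M.formula φ = lift (M.term Cl.vx ≫ M.relation φ) (M.term Cl.vy) ≫ cap (M.typ A') := by
  rw [term_vx, relation]
  exact eq_lift_bend (X := 𝟙_ B ⊗ M.typ A) (λ_ (M.typ A)) (M.formula φ)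

theorem relation_eq_of {A A' : S.Typ} {φ : Formula S [A', A]} {R : M.typ A ⟶ M.typ A'}
    (h : M.formula φ = lift (M.term Cl.vx ≫ R) (M.term Cl.vy) ≫ cap (M.typ A')) :
    M.relation φ = R := by
  rw [term_vx] at h
  exact bend_eq_of (λ_ (M.typ A)) h

theorem relation_mono {A A' : S.Typ} {φ ψ : Formula S [A', A]} (h : M.formula φ ≤ M.formula ψ) :
    M.relation φ ≤ M.relation ψ :=
  comp_mono le_rfl (bend_mono h)

/-- Unbending is monotone as well, so no information about the order is lost; faithfulness rests on
this. -/
theorem formula_le_of_relation_le {A A' : S.Typ} {φ ψ : Formula S [A', A]}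
    (h : M.relation φ ≤ M.relation ψ) : M.formula φ ≤ M.formula ψ := by
  rw [formula_eq_relation, formula_eq_relation]
  exact comp_mono (lift_mono (comp_mono le_rfl h) le_rfl) le_rfl

theorem formula_at {Γ : Ctx S} {A A' : S.Typ} (φ : Formula S [A', A]) (s : Term S Γ A)
    (t : Term S Γ A') :
    M.formula (φ.at s t) = lift (M.term s ≫ M.relation φ) (M.term t) ≫ cap (M.typ A') := by
  rw [Formula.at, formula_subst, formula_eq_relation, comp_lift_assoc, ← Category.assoc,
    ← term_subst, ← term_subst]
  rfl

theorem term_ap {Γ : Ctx S} {A A' : S.Typ} (t : Term S [A] A') (s : Term S Γ A) :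
    M.term (t.ap s) = M.term s ≫ (λ_ (M.typ A)).inv ≫ M.term t := by
  rw [Term.ap, term_subst, subst_cons]
  exact congr($(lift_discard_eq (M.term s)) ≫ M.term t).trans (Category.assoc _ _ _)

theorem relation_graphF {A A' : S.Typ} (t : Term S [A] A') :
    M.relation (Cl.graphF t) = (λ_ (M.typ A)).inv ≫ M.term t :=
  M.relation_eq_of (by rw [Cl.graphF, formula_eq, term_ap])

theorem term_v {A : S.Typ} : M.term (Cl.v : Term S [A] A) = (λ_ (M.typ A)).hom :=
  (leftUnitor_eq_snd _).symm

theorem relation_idF (A : S.Typ) : M.relation (Cl.idF A) = 𝟙 (M.typ A) :=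
  M.relation_eq_of (by rw [Cl.idF, formula_eq, Category.comp_id])

theorem relation_compF {A₁ A₂ A₃ : S.Typ} (φ : Formula S [A₂, A₁]) (ψ : Formula S [A₃, A₂]) :
    M.relation (Cl.compF φ ψ) = M.relation φ ≫ M.relation ψ := by
  refine M.relation_eq_of ?_
  rw [Cl.compF, formula_ex, formula_and, formula_at, formula_at,
    -- The composite `∃ y, φ(x, y) ∧ ψ(y, z)` has exactly the form of the left-hand side of this
    -- lemma.
    ← coproj_act_lift_cap (M.term Cl.vx) (M.relation φ) (M.relation ψ) (M.term Cl.vy),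
    ← Category.assoc (fst _ _), ← term_wk, ← term_wk]
  rfl

theorem relation_tensorF {A₁ A₂ A₁' A₂' : S.Typ} (φ : Formula S [A₁', A₁])
    (ψ : Formula S [A₂', A₂]) :
    M.relation (Cl.tensorF φ ψ) = M.relation φ ⊗ₘ M.relation ψ := by
  refine M.relation_eq_of ?_
  rw [Cl.tensorF, formula_and, formula_at, formula_at]
  exact act_lift_cap_tensor (M.deterministic_term (Cl.vx : Term S [.prod A₁' A₂', .prod A₁ A₂] _))
    (M.deterministic_term (Cl.vy : Term S [.prod A₁' A₂', .prod A₁ A₂] _))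
    (M.relation φ) (M.relation ψ)

/-- The sole variable of a context is the left unitor; it cancels the inverse unitor in `relation`,
which leaves the term as a function of its argument. -/
theorem inv_comp_term_v {A : S.Typ} {X : B} (f : M.typ A ⟶ X) :
    (λ_ (M.typ A)).inv ≫ M.term (Cl.v : Term S [A] A) ≫ f = f := by
  rw [term_v]
  exact Iso.inv_hom_id_assoc _ _

theorem relation_assocTm (A₁ A₂ A₃ : S.Typ) : M.relation (Cl.graphF (Cl.assocTm A₁ A₂ A₃)) =
    (α_ (M.typ A₁) (M.typ A₂) (M.typ A₃)).hom := by
  rw [relation_graphF]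
  refine Eq.trans ?_ (M.inv_comp_term_v (A := .prod (.prod A₁ A₂) A₃)
    (α_ (M.typ A₁) (M.typ A₂) (M.typ A₃)).hom)
  exact congr((λ_ _).inv ≫ $(comp_associator
    (M.deterministic_term (Cl.v : Term S [.prod (.prod A₁ A₂) A₃] _)))).symm

theorem relation_lunitTm (A : S.Typ) :
    M.relation (Cl.graphF (Cl.lunitTm A)) = (λ_ (M.typ A)).hom := by
  rw [relation_graphF, leftUnitor_eq_snd]
  exact M.inv_comp_term_v (A := .prod .unit A) (snd (𝟙_ B) (M.typ A))

theorem relation_runitTm (A : S.Typ) :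
    M.relation (Cl.graphF (Cl.runitTm A)) = (ρ_ (M.typ A)).hom := by
  rw [relation_graphF, rightUnitor_eq_fst]
  exact M.inv_comp_term_v (A := .prod A .unit) (fst (M.typ A) (𝟙_ B))

theorem relation_swapTm (A₁ A₂ : S.Typ) :
    M.relation (Cl.graphF (Cl.swapTm A₁ A₂)) = (β_ (M.typ A₁) (M.typ A₂)).hom := by
  rw [relation_graphF]
  refine Eq.trans ?_ (M.inv_comp_term_v (A := .prod A₁ A₂)
    (β_ (M.typ A₁) (M.typ A₂)).hom)
  exact congr((λ_ _).inv ≫ $(comp_braiding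
    (M.deterministic_term (Cl.v : Term S [.prod A₁ A₂] _)))).symm

theorem relation_copy (A : S.Typ) :
    M.relation (Cl.graphF (.pair Cl.v Cl.v : Term S [A] _)) = Δ[M.typ A] := by
  rw [relation_graphF]
  refine Eq.trans ?_ (M.inv_comp_term_v Δ[M.typ A])
  exact congr((λ_ _).inv ≫ $(comp_copy (M.term (Cl.v : Term S [A] _)))).symm

theorem relation_discard (A : S.Typ) :
    M.relation (Cl.graphF (.star : Term S [A] _)) = ε[M.typ A] := by
  rw [relation_graphF]
  exact Deterministic.discard_natural (λ_ (M.typ A)).inv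

theorem relation_rel {A A' : S.Typ} (R : S.Rel A A') :
    M.relation (.rel R Cl.vx Cl.vy) = M.rel R :=
  M.relation_eq_of (M.formula_rel R _ _)

end Interpretation

variable {S : Signature.{u, v}} {B : Type u₁} [Category.{v₁} B] [MonoidalCategory.{v₁} B]
  [BicategoryOfRelations B] {M : Interpretation S B} {T : Theory S}

namespace Interpretation.Models

/-- The functor out of the classifying category of a theory given by a model. -/
def functor (hM : M.Models T) : Cl T ⥤ B where
  obj A := M.typ A
  -- Soundness in both directions makes the relation independent of the representative.
  map := Quotient.lift M.relation fun _ _ h =>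
    le_antisymm (M.relation_mono (hM.sound h.1)) (M.relation_mono (hM.sound h.2))
  map_id A := M.relation_idF A
  map_comp := by
    rintro _ _ _ ⟨φ⟩ ⟨ψ⟩
    exact M.relation_compF φ ψ

variable (hM : M.Models T)

theorem functor_map_tensor {A₁ A₂ A₁' A₂' : Cl T} (f : A₁ ⟶ A₁') (g : A₂ ⟶ A₂') :
    hM.functor.map (f ⊗ₘ g) = hM.functor.map f ⊗ₘ hM.functor.map g := by
  rcases f with ⟨φ⟩
  rcases g with ⟨ψ⟩
  exact M.relation_tensorF φ ψ

theorem functor_map_whiskerRight {A A' : Cl T} (f : A ⟶ A') (X : Cl T) :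
    hM.functor.map (f ▷ X) = hM.functor.map f ▷ hM.functor.obj X := by
  have := hM.functor_map_tensor f (𝟙 X)
  rwa [CategoryTheory.Functor.map_id, tensorHom_id, tensorHom_id] at this

theorem functor_map_whiskerLeft (X : Cl T) {A A' : Cl T} (f : A ⟶ A') :
    hM.functor.map (X ◁ f) = hM.functor.obj X ◁ hM.functor.map f := by
  have := hM.functor_map_tensor (𝟙 X) f
  rwa [CategoryTheory.Functor.map_id, id_tensorHom, id_tensorHom] at this

theorem functor_map_braiding (A₁ A₂ : Cl T) :
    hM.functor.map (β_ A₁ A₂).hom = (β_ (hM.functor.obj A₁) (hM.functor.obj A₂)).hom :=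
  congr(hM.functor.map $(Cl.mk_braidF A₁ A₂)).trans (M.relation_swapTm A₁ A₂)

/-- The functor given by a model is strictly monoidal. -/
def coreMonoidal : hM.functor.CoreMonoidal where
  -- Product types and the unit type evaluate to tensor products and `I` by definition.
  εIso := Iso.refl _
  μIso _ _ := Iso.refl _
  μIso_hom_natural_left f X' := by
    rw [functor_map_whiskerRight]
    exact (Category.comp_id _).trans (Category.id_comp _).symm
  μIso_hom_natural_right X' f := by
    rw [functor_map_whiskerLeft]
    exact (Category.comp_id _).trans (Category.id_comp _).symm
  associativity X Y Z := refl_associativity (M.relation_assocTm X Y Z)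
  left_unitality X := refl_left_unitality (M.relation_lunitTm X)
  right_unitality X := refl_right_unitality (M.relation_runitTm X)

instance : hM.functor.Monoidal := hM.coreMonoidal.toMonoidal

instance : hM.functor.Braided where
  braided X Y := by
    rw [functor_map_braiding]
    exact (Category.id_comp _).trans (Category.comp_id _).symm

theorem functor_preserves : PreservesStructure hM.functor where
  map_mono {X Y R R'} h := by
    rcases R with ⟨φ⟩
    rcases R' with ⟨ψ⟩
    exact M.relation_mono (hM.sound h)
  map_copy X := (M.relation_copy X).trans (Category.comp_id _).symm
  -- Deletion in `Cl T` is given by `⊤`; it is first rewritten as the graph of `*`.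
  map_discard X := (congr(hM.functor.map $(Cl.discard_eq X)).trans (M.relation_discard X)).trans
    (Category.comp_id _).symm

end Interpretation.Models

end RegularLogic

/-! ### Inverses of structure-preserving equivalences -/

namespace BicategoryOfRelations

open ComonObj Functor.LaxMonoidal Functor.OplaxMonoidal

section

variable {C : Type u₁} [Category.{v₁} C] {D : Type u₂} [Category.{v₂} D] (e : C ≌ D)

/-- The components of the unit of an equivalence. -/
def unitHom (X : C) : X ⟶ e.inverse.obj (e.functor.obj X) := e.unitIso.hom.app X

/-- The components of the counit of an equivalence. -/
def counitHom (X : D) : e.functor.obj (e.inverse.obj X) ⟶ X := e.counitIso.hom.app X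

instance (X : D) : IsIso (counitHom e X) := inferInstanceAs (IsIso (e.counitIso.hom.app X))

theorem unitHom_naturality {X Y : C} (f : X ⟶ Y) :
    f ≫ unitHom e Y = unitHom e X ≫ e.inverse.map (e.functor.map f) :=
  e.unitIso.hom.naturality f

theorem unitHom_naturality_assoc {X Y Z : C} (f : X ⟶ Y) (g : e.inverse.obj (e.functor.obj Y) ⟶ Z) :
    f ≫ unitHom e Y ≫ g = unitHom e X ≫ e.inverse.map (e.functor.map f) ≫ g := by
  rw [← Category.assoc, unitHom_naturality, Category.assoc]

theorem unitHom_counitHom (X : D) :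
    unitHom e (e.inverse.obj X) ≫ e.inverse.map (counitHom e X) = 𝟙 _ :=
  e.unit_inverse_comp X

variable [MonoidalCategory.{v₁} C] [MonoidalCategory.{v₂} D]

/-- The lax structure of the right adjoint is the mate of the oplax structure of the left adjoint.
Questions about the inverse thereby become questions about `δ` and `η` of the functor. -/
theorem inverse_μ [e.functor.Monoidal] [e.inverse.Monoidal] [e.IsMonoidal] (X Y : D) :
    μ e.inverse X Y = unitHom e (e.inverse.obj X ⊗ e.inverse.obj Y) ≫
      e.inverse.map (δ e.functor _ _ ≫ (counitHom e X ⊗ₘ counitHom e Y)) :=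
  Adjunction.IsMonoidal.leftAdjoint_μ (adj := e.toAdjunction) X Y

theorem inverse_ε [e.functor.Monoidal] [e.inverse.Monoidal] [e.IsMonoidal] :
    Functor.LaxMonoidal.ε e.inverse = unitHom e (𝟙_ C) ≫ e.inverse.map (η e.functor) :=
  Adjunction.IsMonoidal.leftAdjoint_ε (adj := e.toAdjunction)

/-- The inverse of a braided monoidal equivalence is braided. -/
@[reducible]
def inverseBraided [BraidedCategory C] [BraidedCategory D] [e.functor.Braided]
    [e.inverse.Monoidal] [e.IsMonoidal] : e.inverse.Braided where
  braided X Y := by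
    have h : δ e.functor (e.inverse.obj X) (e.inverse.obj Y) ≫ (β_ _ _).hom =
        e.functor.map (β_ _ _).hom ≫ δ e.functor _ _ := by
      rw [Functor.map_braiding]
      simp
    rw [inverse_μ, inverse_μ, unitHom_naturality_assoc, Category.assoc,
      ← CategoryTheory.Functor.map_comp, ← CategoryTheory.Functor.map_comp, Category.assoc,
      BraidedCategory.braiding_naturality, reassoc_of% h]

/-- For the order, the functor reflects it by `h'`, and its composite with the inverse is
conjugation by the counit, which is monotone. For the diagonals, the counit components are
isomorphisms, hence comonoid homomorphisms; after moving the diagonal across them, the triangle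
identity cancels unit and counit. -/
theorem inverse_preserves [BicategoryOfRelations C] [BicategoryOfRelations D]
    [e.functor.Braided] [e.inverse.Braided] [e.IsMonoidal] (h : PreservesStructure e.functor)
    (h' : ∀ {X Y : C} {R S : X ⟶ Y}, e.functor.map R ≤ e.functor.map S → R ≤ S) :
    PreservesStructure e.inverse where
  map_mono {X Y R S} hRS := by
    refine h' ?_
    rw [e.fun_inv_map, e.fun_inv_map]
    exact comp_mono le_rfl (comp_mono hRS le_rfl)
  map_copy X := by
    rw [inverse_μ, unitHom_naturality_assoc, ← CategoryTheory.Functor.map_comp, h.map_copy,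
      Category.assoc, Functor.Monoidal.μ_δ_assoc, ← Deterministic.copy_natural (counitHom e X),
      CategoryTheory.Functor.map_comp, reassoc_of% unitHom_counitHom e X]
  map_discard X := by
    rw [inverse_ε, unitHom_naturality_assoc, ← CategoryTheory.Functor.map_comp, h.map_discard,
      Category.assoc, Functor.Monoidal.ε_η, Category.comp_id,
      ← Deterministic.discard_natural (counitHom e X),
      CategoryTheory.Functor.map_comp, reassoc_of% unitHom_counitHom e X]

theorem nonempty_structuredEquivalence [BicategoryOfRelations C] [BicategoryOfRelations D]
    [e.functor.Braided] (h : PreservesStructure e.functor)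
    (h' : ∀ {X Y : C} {R S : X ⟶ Y}, e.functor.map R ≤ e.functor.map S → R ≤ S) :
    Nonempty (StructuredEquivalence C D) := by
  let := e.inverseMonoidal
  -- The monoidal structure of the inverse is defined through the adjunction, so the compatibility
  -- of unit and counit holds by definition.
  have hm : e.IsMonoidal := ⟨rfl, fun _ _ => rfl⟩
  let := inverseBraided e
  exact ⟨{
    toEquivalence := e
    isMonoidal := hm
    functor_preserves := h
    inverse_preserves := inverse_preserves e h h' }⟩

end

end BicategoryOfRelations

/-! ### The canonical functor of the internal language -/

namespace RegularLogic

open BicategoryOfRelations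

variable (B : Type u) [Category.{v} B] [MonoidalCategory.{v} B] [BicategoryOfRelations B]

theorem langInterpretation_models : (langInterpretation B).Models (Lang B) := fun _ _ _ h => h

/-- The canonical functor from the classifying category of the internal language. -/
abbrev langFunctor : Cl (Lang B) ⥤ B := (langInterpretation_models B).functor

variable {B} in
-- Completeness costs nothing: an inequality that holds in `B` is an axiom of `Lang B`.
theorem le_of_langFunctor_map_le {X Y : Cl (Lang B)} {R R' : X ⟶ Y}
    (h : (langFunctor B).map R ≤ (langFunctor B).map R') : R ≤ R' := by
  rcases R with ⟨φ⟩
  rcases R' with ⟨ψ⟩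
  exact Theory.Entails.ax ((langInterpretation B).formula_le_of_relation_le h)

instance : (langFunctor B).Faithful where
  map_injective h :=
    le_antisymm (le_of_langFunctor_map_le h.le) (le_of_langFunctor_map_le h.ge)

instance : (langFunctor B).Full where
  map_surjective {X Y} R :=
    -- `R` is a relation symbol between the types `X` and `Y` themselves, also when these are
    -- compound.
    ⟨Cl.mk (.rel (S := langSignature B) (A := X) (B := Y) R Cl.vx Cl.vy),
      (langInterpretation B).relation_rel _⟩

instance : (langFunctor B).EssSurj where
  mem_essImage X := ⟨Ty.basic X, ⟨Iso.refl X⟩⟩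

instance : (langFunctor B).IsEquivalence where

end RegularLogic

theorem mainTheorem3 {B : Type u} [CategoryTheory.Category.{v} B]
    [CategoryTheory.MonoidalCategory.{v} B] [BicategoryOfRelations B] :
    Nonempty (BicategoryOfRelations.StructuredEquivalence
      (RegularLogic.Cl (RegularLogic.Lang B)) B) := by
  exact @BicategoryOfRelations.nonempty_structuredEquivalence _ _ _ _
    (RegularLogic.langFunctor B).asEquivalence _ _ _ _
    -- The functor of `asEquivalence` is `langFunctor B` by definition, so its braided structure
    -- carries over.
    (inferInstanceAs (RegularLogic.langFunctor B).Braided)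
    (RegularLogic.langInterpretation_models B).functor_preserves
    RegularLogic.le_of_langFunctor_map_le
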